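/- Let $k$ be a number field and let $\varepsilon>0$. There is a constant $C=C(k,\varepsilon)>0$ such that for every squarefree integral ideal $\mathfrak q$ of $\mathcal O_k$ and every real $X>0$, the number of $k$-isomorphism classes of non-cyclic cubic extensions $K/k$ that are partially ramified at every prime $\mathfrak p\mid\mathfrak q$ (that is, $\mathfrak p\mathcal O_K=\mathfrak P_1^2\mathfrak P_2$ with distinct primes $\mathfrak P_1,\mathfrak P_2$ of $\mathcal O_K$) and whose absolute discriminant satisfies $|\mathrm{disc}(K/\mathbb Q)|\le X$ is finite and at most $$C\,\frac{X}{|\mathfrak q|^{1/6-\varepsilon}},$$ where $|\mathfrak q|=N_{k/\mathbb Q}(\mathfrak q)$ is the absolute norm. The constant $C$ does not depend on $\mathfrak q$ or $X$. -/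

import Mathlib

open NumberField

/-- The extension `K / k` is cyclic: it is Galois with cyclic Galois group. -/
def IsCyclicExtension (k K : Type*) [Field k] [Field K] [Algebra k K] : Prop :=
  IsGalois k K ∧ IsCyclic (K ≃ₐ[k] K)

/-- A prime `p` of `k` is partially ramified in the cubic extension `K / k`:
`p 𝓞_K = P₁² P₂` with distinct primes `P₁`, `P₂` of `K`. -/
def IsPartiallyRamified (k K : Type*) [Field k] [Field K] [Algebra k K]
    (p : Ideal (𝓞 k)) : Prop :=
  ∃ P₁ P₂ : Ideal (𝓞 K), P₁.IsPrime ∧ P₂.IsPrime ∧ P₁ ≠ P₂ ∧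
    p.map (algebraMap (𝓞 k) (𝓞 K)) = P₁ ^ 2 * P₂

/-- The cubic extensions of `k` inside its algebraic closure. -/
abbrev CubicExtension (k : Type*) [Field k] : Type _ :=
  {K : IntermediateField k (AlgebraicClosure k) // Module.finrank k K = 3}

instance CubicExtension.instNumberField {k : Type*} [Field k] [NumberField k]
    (K : CubicExtension k) : NumberField K.1 :=
  have : FiniteDimensional k K.1 := Module.finite_of_finrank_pos (by rw [K.2]; norm_num)
  NumberField.of_module_finite k K.1

/-- Two cubic extensions of `k` are identified when they are isomorphic over `k`. -/
instance CubicExtension.instSetoid (k : Type*) [Field k] : Setoid (CubicExtension k) where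
  r K L := Nonempty (K.1 ≃ₐ[k] L.1)
  iseqv :=
    { refl := fun _ => ⟨AlgEquiv.refl⟩
      symm := fun ⟨e⟩ => ⟨e.symm⟩
      trans := fun ⟨e⟩ ⟨f⟩ => ⟨e.trans f⟩ }

/-- The set of `k`-isomorphism classes of non-cyclic cubic extensions `K / k` that are partially
ramified at every prime dividing `q` and have absolute discriminant `|disc (K / ℚ)| ≤ X`. -/
def partiallyRamifiedCubicClasses (k : Type*) [Field k] [NumberField k]
    (q : Ideal (𝓞 k)) (X : ℝ) : Set (Quotient (CubicExtension.instSetoid k)) :=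
  (fun K => Quotient.mk (CubicExtension.instSetoid k) K) ''
    {K : CubicExtension k | ¬ IsCyclicExtension k K.1 ∧
      (∀ p : Ideal (𝓞 k), p.IsPrime → p ∣ q → IsPartiallyRamified k K.1 p) ∧
      |(NumberField.discr K.1 : ℝ)| ≤ X}

/-! Put n = [k:ℚ] and N = N(q), and let ω be the number of primes dividing q. Cubic fields are
counted through cubic polynomials over 𝓞 k, on which ramification becomes a congruence condition.

Let l₁ ≤ l₂ be the successive minima, over k and with respect to the house, of the trace-zero
integers of K. Packing against a volume bound gives (l₁l₂)^n ≪ √|disc K| (`exists_reduced_pair`).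
After clearing a bounded denominator and shifting the basis so that AB ∈ k, associativity yields the
Delone–Faddeev table, whose coefficients a, b, c, d have houses ≪ l₁²/l₂, l₁, l₂, l₂²/l₁
(`exists_cubic_form`). Translating the variable by m of house at most l₂/l₁ stays in this box up to
constants, so K owns ≫ (l₂/l₁)^n tuples, and each tuple determines K up to isomorphism
(`exists_cubic_family`).

At a ramified p either a or the discriminant lies in p. The discriminant is quadratic in d with
leading coefficient -27a², so for p not dividing 3a at most two classes of d survive. A box
therefore holds ≪ 4^ω l₁^(3n) (1 + (l₂²/l₁)^n / N) tuples (`card_cubic_le`). Dividing by (l₂/l₁)^n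
leaves 4^ω (l₁^(4n)/l₂^n + l₁^(3n) l₂^n / N) fields. The sum over dyadic boxes with (l₁l₂)^n ≪ √X is
≪ 4^ω (X^(3/4) + X/N) (`sum_dyadic_le`).

If there is any field at all, then N ≤ |disc K| ≤ X (`prod_absNorm_le_abs_discr`), so both terms are
at most X/N^(1/4). Since 4^ω ≪ N^(1/12), the bound X/N^(1/6) follows. -/

/-! ### Packing bounds and lattice point counts -/

open MeasureTheory Module in
/-- A `δ`-separated set in a ball of radius `R` of a `d`-dimensional real normed space has at most
`(1 + 2R/δ)^d` elements. -/
theorem card_le_of_separated_of_norm_le {E : Type*} [NormedAddCommGroup E] [NormedSpace ℝ E]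
    [FiniteDimensional ℝ E] (s : Finset E) {R δ : ℝ} (hR : 0 ≤ R) (hδ : 0 < δ)
    (hs : ∀ c ∈ s, ‖c‖ ≤ R) (h : ∀ c ∈ s, ∀ d ∈ s, c ≠ d → δ ≤ ‖c - d‖) :
    (s.card : ℝ) ≤ (1 + 2 * R / δ) ^ finrank ℝ E := by
  borelize E
  let μ : Measure E := Measure.addHaar
  have ρpos : 0 < R + δ / 2 := by positivity
  have hδ2 : 0 < δ / 2 := by positivity
  have D : Set.Pairwise (s : Set E)
      (Function.onFun Disjoint fun c => Metric.ball (c : E) (δ / 2)) := by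
    rintro c hc d hd hcd
    apply Metric.ball_disjoint_ball
    rw [dist_eq_norm]
    linarith [h c hc d hd hcd]
  have A_subset : (⋃ c ∈ s, Metric.ball (c : E) (δ / 2)) ⊆ Metric.ball (0 : E) (R + δ / 2) := by
    refine Set.iUnion₂_subset fun x hx => Metric.ball_subset_ball' ?_
    rw [dist_zero_right]
    linarith [hs x hx]
  have I : (s.card : ENNReal) * ENNReal.ofReal ((δ / 2) ^ finrank ℝ E) * μ (Metric.ball 0 1) ≤
      ENNReal.ofReal ((R + δ / 2) ^ finrank ℝ E) * μ (Metric.ball 0 1) :=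
    calc
      _ = μ (⋃ c ∈ s, Metric.ball (c : E) (δ / 2)) := by
        rw [measure_biUnion_finset D fun c _ => measurableSet_ball]
        simp only [μ.addHaar_ball_of_pos _ hδ2]
        simp only [Finset.sum_const, nsmul_eq_mul, mul_assoc]
      _ ≤ μ (Metric.ball (0 : E) (R + δ / 2)) := measure_mono A_subset
      _ = _ := by simp only [μ.addHaar_ball_of_pos _ ρpos]
  have J := (ENNReal.mul_le_mul_iff_left (Metric.measure_ball_pos _ _ zero_lt_one).ne'
    measure_ball_lt_top.ne).1 I
  have K := ENNReal.toReal_le_of_le_ofReal (by positivity) J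
  rw [ENNReal.toReal_mul, ENNReal.toReal_natCast, ENNReal.toReal_ofReal (by positivity)] at K
  rw [show 1 + 2 * R / δ = (R + δ / 2) / (δ / 2) by field_simp; ring, div_pow,
    le_div_iff₀ (by positivity)]
  exact K

open Module in
/-- A `δ`-separated set of elements of house at most `R` on a `k`-line in `K` has at most
`(1 + 2R/δ)^[k:ℚ]` elements. -/
theorem card_le_of_separated_of_house_le {k K : Type*} [Field k] [NumberField k] [Field K]
    [NumberField K] [Algebra k K] (α : K) (s : Finset K) {R δ : ℝ} (hR : 0 ≤ R) (hδ : 0 < δ)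
    (hα : ∀ x ∈ s, ∃ y : k, x = algebraMap k K y * α)
    (hs : ∀ x ∈ s, house x ≤ R) (h : ∀ x ∈ s, ∀ y ∈ s, x ≠ y → δ ≤ house (x - y)) :
    (s.card : ℝ) ≤ (1 + 2 * R / δ) ^ finrank ℚ k := by
  classical
  let b := integralBasis k
  let f : Free.ChooseBasisIndex ℤ (𝓞 k) → ((K →+* ℂ) → ℂ) :=
    fun i => canonicalEmbedding K (algebraMap k K (b i) * α)
  let W : Submodule ℝ ((K →+* ℂ) → ℂ) := Submodule.span ℝ (Set.range f)
  -- The packing takes place in the real span of a single k-line, hence the exponent [k:ℚ] instead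
  -- of [K:ℚ].
  have hW : finrank ℝ W ≤ finrank ℚ k := by
    rw [finrank_eq_card_basis b]
    exact finrank_range_le_card f
  have hmem : ∀ x ∈ s, canonicalEmbedding K x ∈ W := by
    intro x hx
    obtain ⟨y, rfl⟩ := hα x hx
    rw [← b.sum_repr y, map_sum, Finset.sum_mul, map_sum]
    refine W.sum_mem fun i _ => ?_
    have : canonicalEmbedding K (algebraMap k K (b.repr y i • b i) * α) =
        ((b.repr y i : ℚ) : ℝ) • f i := by
      ext φ
      simp only [f, Algebra.smul_def, map_mul, eq_ratCast, map_ratCast, Pi.smul_apply,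
        canonicalEmbedding.apply_at, Pi.mul_apply]
      ring
    rw [this]
    exact W.smul_mem _ (Submodule.subset_span ⟨i, rfl⟩)
  let g : s → W := fun x => ⟨canonicalEmbedding K x, hmem x x.2⟩
  have hg : Function.Injective g := by
    intro x y hxy
    exact Subtype.ext (canonicalEmbedding_injective K (congrArg Subtype.val hxy))
  have := card_le_of_separated_of_norm_le (Finset.univ.image g) hR hδ
    (by
      intro c hc
      obtain ⟨x, -, rfl⟩ := Finset.mem_image.1 hc
      exact hs x x.2)
    (by
      intro c hc d hd hcd
      obtain ⟨x, -, rfl⟩ := Finset.mem_image.1 hc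
      obtain ⟨y, -, rfl⟩ := Finset.mem_image.1 hd
      have := h x x.2 y y.2 fun hxy => hcd (by rw [Subtype.ext hxy])
      rw [house, map_sub] at this
      exact this)
  rw [Finset.card_image_of_injective _ hg, Finset.card_univ, Fintype.card_coe] at this
  exact this.trans (pow_le_pow_right₀ (by have : 0 ≤ 2 * R / δ := (by positivity); linarith) hW)

/-- A nonzero element of an ideal `I` satisfies `N(I) ≤ house(x)^[k:ℚ]`. -/
theorem absNorm_le_house_pow {k : Type*} [Field k] [NumberField k] (I : Ideal (𝓞 k)) {x : 𝓞 k}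
    (hx : x ∈ I) (h0 : x ≠ 0) :
    (Ideal.absNorm I : ℝ) ≤ house (x : k) ^ Module.finrank ℚ k := by
  have h1 : Ideal.absNorm I ∣ (Algebra.norm ℤ x).natAbs := by
    rw [← Ideal.absNorm_span_singleton]
    exact Ideal.absNorm_dvd_absNorm_of_le ((Ideal.span_singleton_le_iff_mem I).2 hx)
  have h2 : (Ideal.absNorm I : ℝ) ≤ |(Algebra.norm ℤ x : ℝ)| := by
    have := Nat.le_of_dvd (Int.natAbs_pos.2 (Algebra.norm_ne_zero_iff.2 h0)) h1
    rw [← Int.cast_abs, ← Int.natCast_natAbs, Int.cast_natCast]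
    exact_mod_cast this
  obtain ⟨σ⟩ : Nonempty (k →+* ℂ) := inferInstance
  have h3 := norm_norm_le_norm_mul_house_pow (x : k) σ
  rw [← Algebra.coe_norm_int, ← Rat.norm_cast_real, Real.norm_eq_abs, Rat.cast_intCast] at h3
  calc (Ideal.absNorm I : ℝ) ≤ _ := h2.trans h3
    _ ≤ house (x : k) * house (x : k) ^ (Module.finrank ℚ k - 1) := by
        gcongr
        · exact pow_nonneg (house_nonneg _) _
        · exact norm_embedding_le_house _ _
    _ = _ := mul_pow_sub_one Module.finrank_pos.ne' _

theorem finite_setOf_house_le (F : Type*) [Field F] [NumberField F] (R : ℝ) :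
    {x : 𝓞 F | house (x : F) ≤ R}.Finite := by
  refine Set.Finite.of_finite_image (f := fun x : 𝓞 F => (x : F)) ?_
    RingOfIntegers.coe_injective.injOn
  refine (Embeddings.finite_of_norm_le F ℂ R).subset ?_
  rintro _ ⟨x, hx, rfl⟩
  exact ⟨x.2, fun φ => (norm_embedding_le_house _ φ).trans hx⟩

open MeasureTheory in
/-- If every translate of `S` contains at most `M` lattice points, then `vol S ≤ M * covol`. -/
theorem measure_le_mul_of_card_le {E L : Type*} [MeasurableSpace E] [AddGroup L] [Countable L]
    [AddAction L E] [MeasurableSpace L] [MeasurableVAdd L E] {μ : Measure E}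
    [VAddInvariantMeasure L E μ] {F S : Set E} (hF : IsAddFundamentalDomain L F μ)
    (hS : MeasurableSet S) (M : ℕ) (h : ∀ x : E, {g : L | g +ᵥ x ∈ S}.encard ≤ M) :
    μ S ≤ M * μ F := by
  -- Unfolding: the measure of S is the integral over F of the number of lattice translates of x
  -- that fall in S.
  rw [← lintegral_indicator_one hS, hF.lintegral_eq_tsum'', ← lintegral_tsum]
  · calc _ ≤ ∫⁻ _ in F, (M : ENNReal) ∂μ := by
          refine lintegral_mono fun x => ?_
          have : (∑' g : L, S.indicator (1 : E → ENNReal) (g +ᵥ x)) =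
              ∑' g : L, ({g : L | g +ᵥ x ∈ S}.indicator (1 : L → ENNReal)) g := rfl
          rw [this, ← tsum_subtype]
          simp only [Pi.one_apply, ENNReal.tsum_set_one]
          exact_mod_cast h x
      _ = _ := by rw [lintegral_const, Measure.restrict_apply_univ]
  · intro g
    exact ((measurable_one.indicator hS).comp (measurable_const_vadd g)).aemeasurable

open MeasureTheory mixedEmbedding Module in
/-- The number of integers of house at most `2r` is at least `r^[F:ℚ] / √|disc F|`. -/
theorem pow_le_card_mul_sqrt_discr (F : Type*) [Field F] [NumberField F] {r : ℝ} (hr : 0 < r)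
    (T : Finset (𝓞 F)) (hT : ∀ x : 𝓞 F, house (x : F) ≤ 2 * r → x ∈ T) :
    r ^ finrank ℚ F ≤ T.card * √|(discr F : ℝ)| := by
  classical
  lift r to NNReal using hr.le
  let f : InfinitePlace F → NNReal := fun _ => r
  have hF := ZSpan.isAddFundamentalDomain' (latticeBasis F) volume
  have : Countable (Submodule.span ℤ (Set.range (latticeBasis F))).toAddSubgroup := by
    change Countable (Submodule.span ℤ (Set.range (latticeBasis F)))
    infer_instance
  have hS : MeasurableSet (convexBodyLT F f) :=
    (MeasurableSet.univ_pi fun _ => measurableSet_ball).prod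
      (MeasurableSet.univ_pi fun _ => measurableSet_ball)
  have key := measure_le_mul_of_card_le hF hS T.card ?_
  · rw [convexBodyLT_volume, volume_fundamentalDomain_latticeBasis,
      show ∏ w, f w ^ w.mult = r ^ ∑ w : InfinitePlace F, w.mult from
        Finset.prod_pow_eq_pow_sum _ _ _,
      InfinitePlace.sum_mult_eq] at key
    have h1 : ENNReal.ofNNReal (r ^ finrank ℚ F) ≤
        ENNReal.ofNNReal (T.card * NNReal.sqrt ‖discr F‖₊) := by
      push_cast
      calc _ = 1 * (r : ENNReal) ^ finrank ℚ F := (one_mul _).symm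
        _ ≤ _ := by
          refine mul_le_mul_left ?_ _
          exact_mod_cast one_le_convexBodyLTFactor F
        _ ≤ _ := key
        -- The covolume carries a negative power of 2 from the complex places, which is dropped.
        _ ≤ T.card * (1 * (NNReal.sqrt ‖discr F‖₊ : ENNReal)) := by
          gcongr
          exact pow_le_one₀ zero_le (by simp)
        _ = _ := by rw [one_mul]
    have h2 : r ^ finrank ℚ F ≤ T.card * NNReal.sqrt ‖discr F‖₊ := by
      exact_mod_cast h1
    have h3 := NNReal.coe_le_coe.2 h2
    simpa [Int.norm_eq_abs] using h3
  · intro x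
    rcases Set.eq_empty_or_nonempty
      {g : (Submodule.span ℤ (Set.range (latticeBasis F))).toAddSubgroup |
        g +ᵥ x ∈ convexBodyLT F f} with h0 | ⟨g₀, hg₀⟩
    · rw [h0]
      simp
    -- Two lattice points of the same translate differ by an integer of house at most 2r, so
    -- subtracting a fixed g₀ injects the points into T.
    · have hex : ∀ g : (Submodule.span ℤ (Set.range (latticeBasis F))).toAddSubgroup,
          ∃ a : 𝓞 F, mixedEmbedding F (a : F) = (g : mixedSpace F) - g₀ := by
        intro g
        have := (g - g₀).2
        rw [Submodule.mem_toAddSubgroup, mem_span_latticeBasis] at this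
        obtain ⟨a, ha⟩ := this
        exact ⟨a, ha⟩
      choose a ha using hex
      have hinj : Function.Injective a := by
        intro g g' h
        have h1 := ha g
        rw [h, ha g'] at h1
        exact Subtype.ext (sub_left_injective h1).symm
      rw [← hinj.encard_image, ← Set.encard_coe_eq_coe_finsetCard]
      refine Set.encard_le_encard ?_
      rintro _ ⟨g, hg, rfl⟩
      refine hT _ ?_
      have hmem : mixedEmbedding F (a g : F) ∈ convexBodyLT F (fun _ => 2 * r) := by
        rw [ha g]
        have e1 : g +ᵥ x = (g : mixedSpace F) + x := rfl
        have e2 : g₀ +ᵥ x = (g₀ : mixedSpace F) + x := rfl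
        rw [Set.mem_ofPred_eq, e1] at hg
        rw [Set.mem_ofPred_eq, e2] at hg₀
        simp only [Set.mem_prod, Set.mem_pi, mem_ball_zero_iff, Prod.fst_sub, Prod.snd_sub,
          Prod.fst_add, Prod.snd_add, Pi.sub_apply, Pi.add_apply, f, NNReal.coe_mul, NNReal.coe_ofNat] at hg hg₀ ⊢
        constructor
        · intro w hw
          have := norm_sub_le ((g : mixedSpace F).1 w + x.1 w) ((g₀ : mixedSpace F).1 w + x.1 w)
          rw [add_sub_add_right_eq_sub] at this
          linarith [hg.1 w hw, hg₀.1 w hw]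
        · intro w hw
          have := norm_sub_le ((g : mixedSpace F).2 w + x.2 w) ((g₀ : mixedSpace F).2 w + x.2 w)
          rw [add_sub_add_right_eq_sub] at this
          linarith [hg.2 w hw, hg₀.2 w hw]
      rw [convexBodyLT_mem] at hmem
      rw [house, canonicalEmbedding.norm_le_iff]
      intro φ
      rw [← InfinitePlace.apply]
      exact (hmem _).le

/-! ### Successive minima of trace-zero integers -/

section ReducedPair

open Module

variable {k K : Type*} [Field k] [NumberField k] [Field K] [NumberField K] [Algebra k K]

/-- Northcott finiteness: only finitely many integers have bounded house, so the minimum is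
attained. -/
theorem exists_min_house {F : Type*} [Field F] [NumberField F] {P : 𝓞 F → Prop}
    (hP : ∃ x, P x) : ∃ x, P x ∧ ∀ y, P y → house (x : F) ≤ house (y : F) := by
  obtain ⟨x₀, hx₀⟩ := hP
  obtain ⟨x, ⟨hx, hx'⟩, h⟩ := Set.exists_min_image
    ({x : 𝓞 F | house (x : F) ≤ house (x₀ : F)} ∩ {x | P x}) (fun x : 𝓞 F => house (x : F))
    ((finite_setOf_house_le F _).inter_of_left _) ⟨x₀, by simp, hx₀⟩
  refine ⟨x, hx', fun y hy => ?_⟩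
  by_cases hy' : house (y : F) ≤ house (x₀ : F)
  · exact h y ⟨hy', hy⟩
  · exact le_trans hx (not_le.1 hy').le

theorem house_algebraMap_le (x : k) : house (algebraMap k K x) ≤ house x := by
  rw [house, canonicalEmbedding.norm_le_iff]
  exact fun σ => norm_embedding_le_house x (σ.comp (algebraMap k K))

theorem house_neg {F : Type*} [Field F] [NumberField F] (x : F) : house (-x) = house x := by
  rw [house, house, map_neg, norm_neg]

theorem house_sub_le {F : Type*} [Field F] [NumberField F] (x y : F) :
    house (x - y) ≤ house x + house y := by
  rw [house, map_sub]
  exact norm_sub_le _ _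

theorem house_algebraMap_trace_le (x : K) :
    house (algebraMap k K (Algebra.trace k K x)) ≤ finrank k K * house x := by
  rw [house, canonicalEmbedding.norm_le_iff]
  intro σ
  let _ : Algebra k ℂ := (σ.comp (algebraMap k K)).toAlgebra
  have h := trace_eq_sum_embeddings (K := k) (L := K) ℂ (x := x)
  have h' : σ (algebraMap k K (Algebra.trace k K x)) = ∑ τ : K →ₐ[k] ℂ, τ x := h
  rw [h']
  calc _ ≤ ∑ τ : K →ₐ[k] ℂ, ‖τ x‖ := norm_sum_le _ _
    _ ≤ ∑ τ : K →ₐ[k] ℂ, house x :=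
        Finset.sum_le_sum fun τ _ => norm_embedding_le_house x (τ : K →+* ℂ)
    _ = _ := by rw [Finset.sum_const, Finset.card_univ, AlgHom.card, nsmul_eq_mul]

variable (k) in
/-- The trace-free part `3x - Tr x` of an integer of a cubic extension. -/
theorem exists_eq_three_mul_sub_trace (x : 𝓞 K) :
    ∃ z : 𝓞 K, (z : K) = 3 * (x : K) - algebraMap k K (Algebra.trace k K (x : K)) := by
  have h1 : IsIntegral ℤ (Algebra.trace k K (x : K)) := Algebra.isIntegral_trace x.2
  have h2 : IsIntegral ℤ (algebraMap k K (Algebra.trace k K (x : K))) :=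
    h1.map ((algebraMap k K).toIntAlgHom)
  obtain ⟨w, hw⟩ : ∃ w : 𝓞 K, (w : K) = algebraMap k K (Algebra.trace k K (x : K)) :=
    ⟨⟨_, h2⟩, rfl⟩
  exact ⟨3 * x - w, by rw [← hw]; simp [map_ofNat (algebraMap (𝓞 K) K)]⟩

theorem trace_three_mul_sub_trace (h3 : finrank k K = 3) (x : K) :
    Algebra.trace k K (3 * x - algebraMap k K (Algebra.trace k K x)) = 0 := by
  have h : (3 : K) * x = (3 : ℕ) • x := by simp
  rw [map_sub, Algebra.trace_algebraMap, h3, h, map_nsmul, sub_self]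

/-- Clearing denominators shows that 𝓞 K spans K over k, and two vectors cannot span a
three-dimensional space. -/
theorem exists_ringOfIntegers_notMem_span_pair (h3 : finrank k K = 3) (α : K) :
    ∃ θ : 𝓞 K, ∀ x y : k, (θ : K) ≠ algebraMap k K x + algebraMap k K y * α := by
  have : FiniteDimensional k K := Module.finite_of_finrank_pos (by omega)
  by_contra! hcon
  have htop : Submodule.span k {1, α} = ⊤ := by
    rw [eq_top_iff]
    rintro z -
    obtain ⟨⟨a, m⟩, hz⟩ := IsLocalization.surj (Algebra.algebraMapSubmonoid (𝓞 K) (nonZeroDivisors ℤ)) z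
    obtain ⟨x, y, hxy⟩ := hcon a
    obtain ⟨m, c, hc, rfl⟩ := m
    have hc' : (c : k) ≠ 0 := by exact_mod_cast nonZeroDivisors.ne_zero hc
    rw [Submodule.mem_span_pair]
    refine ⟨x / c, y / c, ?_⟩
    have hc'' : (c : K) ≠ 0 := by exact_mod_cast nonZeroDivisors.ne_zero hc
    rw [Algebra.smul_def, Algebra.smul_def, map_div₀, map_div₀, map_intCast]
    have hz' : z * (c : K) = (a : K) := by simpa using hz
    rw [hxy] at hz'
    field_simp
    linear_combination -hz'
  classical
  have h4 := finrank_span_finset_le_card (R := k) ({1, α} : Finset K)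
  rw [Set.finrank, Finset.coe_insert, Finset.coe_singleton, htop, finrank_top, h3] at h4
  have h5 := Finset.card_le_two (a := (1 : K)) (b := α)
  omega

/-- A pair of almost shortest integers, independent of `1` over `k`, whose houses have product
bounded by the root of the discriminant. -/
theorem exists_reduced_pair (h3 : finrank k K = 3) : ∃ α β : 𝓞 K,
    (∀ x : k, (α : K) ≠ algebraMap k K x) ∧
    (∀ x y : k, (β : K) ≠ algebraMap k K x + algebraMap k K y * α) ∧
    1 ≤ house (α : K) ∧ house (α : K) ≤ house (β : K) ∧
    (house (α : K) * house (β : K)) ^ finrank ℚ k ≤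
      (6 * 14 ^ 3) ^ finrank ℚ k * √|(discr K : ℝ)| := by
  classical
  -- Used with γ = 0 for the existence of α and with γ = α for that of β.
  have key : ∀ γ : K, ∃ z : 𝓞 K, Algebra.trace k K (z : K) = 0 ∧
      ∀ y : k, (z : K) ≠ algebraMap k K y * γ := by
    intro γ
    obtain ⟨θ, hθ⟩ := exists_ringOfIntegers_notMem_span_pair h3 γ
    obtain ⟨z, hz⟩ := exists_eq_three_mul_sub_trace k θ
    refine ⟨z, by rw [hz, trace_three_mul_sub_trace h3], fun y hy => ?_⟩
    refine hθ (Algebra.trace k K (θ : K) / 3) (y / 3) ?_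
    rw [map_div₀, map_div₀, map_ofNat]
    field_simp
    linear_combination hy - hz
  obtain ⟨α, ⟨hα0, hαtr⟩, hαmin⟩ := exists_min_house
    (P := fun z : 𝓞 K => z ≠ 0 ∧ Algebra.trace k K (z : K) = 0) (by
      obtain ⟨z, hz, hz'⟩ := key 0
      exact ⟨z, fun h => hz' 0 (by simp [h]), hz⟩)
  obtain ⟨β, ⟨hβtr, hβ⟩, hβmin⟩ := exists_min_house
    (P := fun z : 𝓞 K => Algebra.trace k K (z : K) = 0 ∧
      ∀ y : k, (z : K) ≠ algebraMap k K y * α) (key α)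
  have hβ0 : β ≠ 0 := fun h => hβ 0 (by simp [h])
  have hα1 : 1 ≤ house (α : K) := one_le_house_of_isIntegral α.2 (by simpa using hα0)
  have hle := hαmin β ⟨hβ0, hβtr⟩
  have htr : ∀ x : k, Algebra.trace k K (algebraMap k K x) = 0 → x = 0 := by
    intro x hx
    rw [Algebra.trace_algebraMap, h3] at hx
    simpa using hx
  refine ⟨α, β, ?_, ?_, hα1, hle, ?_⟩
  · intro x hx
    have := htr x (hx ▸ hαtr)
    rw [this, map_zero] at hx
    exact hα0 (by simpa using hx)
  · intro x y hxy
    have h1 : Algebra.trace k K (algebraMap k K x) = 0 := by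
      have : algebraMap k K x = (β : K) - y • (α : K) := by
        rw [hxy, Algebra.smul_def]; ring
      rw [this, map_sub, map_smul, hβtr, hαtr, smul_zero, sub_zero]
    rw [htr x h1, map_zero, zero_add] at hxy
    exact hβ y hxy
  set l₁ := house (α : K)
  set l₂ := house (β : K)
  have hl₁ : 0 < l₁ := by linarith
  have hl₂ : 0 < l₂ := by linarith
  -- Elements of T have house at most l₂/7, and x ↦ 3x - Tr x enlarges the house at most sixfold.
  -- The image has house at most 6l₂/7 < l₂, so minimality of β puts it on the line kα.
  let T : Finset (𝓞 K) := (finite_setOf_house_le K (2 * (l₂ / 14))).toFinset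
  have hvol := pow_le_card_mul_sqrt_discr K (r := l₂ / 14) (by positivity) T (by simp [T])
  choose t ht using exists_eq_three_mul_sub_trace k (K := K)
  have hT : ∀ x ∈ T, house (x : K) ≤ l₂ / 7 := by
    intro x hx
    have : house (x : K) ≤ 2 * (l₂ / 14) := by simpa [T] using hx
    linarith
  have htT : ∀ x ∈ T, house (t x : K) ≤ 6 * (l₂ / 7) := by
    intro x hx
    rw [ht]
    have e1 := house_sub_le (3 * (x : K)) (algebraMap k K (Algebra.trace k K (x : K)))
    have e2 := house_nat_mul (x : K) 3
    have e3 := house_algebraMap_trace_le (k := k) (x : K)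
    rw [h3] at e3
    push_cast at e2 e3
    linarith [hT x hx]
  have httr : ∀ x, Algebra.trace k K (t x : K) = 0 := fun x => by
    rw [ht, trace_three_mul_sub_trace h3]
  have hline : ∀ x ∈ T, ∃ y : k, (t x : K) = algebraMap k K y * α := by
    intro x hx
    by_contra! hcon
    have := hβmin (t x) ⟨httr x, hcon⟩
    linarith [htT x hx]
  have hcoe : Function.Injective (fun x : 𝓞 K => (x : K)) := RingOfIntegers.coe_injective
  -- Distinct points of the image differ by a nonzero trace-zero integer, so minimality of α
  -- separates them by l₁.
  have hIm : ((T.image fun x => (t x : K)).card : ℝ) ≤ (1 + 2 * (6 * (l₂ / 7)) / l₁) ^ finrank ℚ k := by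
    refine card_le_of_separated_of_house_le (k := k) (α : K) _ (by positivity) hl₁ ?_ ?_ ?_
    · intro z hz
      obtain ⟨x, hx, rfl⟩ := Finset.mem_image.1 hz
      exact hline x hx
    · intro z hz
      obtain ⟨x, hx, rfl⟩ := Finset.mem_image.1 hz
      exact htT x hx
    · intro z hz w hw hzw
      obtain ⟨x, hx, rfl⟩ := Finset.mem_image.1 hz
      obtain ⟨y, hy, rfl⟩ := Finset.mem_image.1 hw
      refine hαmin (t x - t y) ⟨fun h => hzw ?_, ?_⟩
      · rw [sub_eq_zero.1 h]
      · simp [httr]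
  -- Integers with the same trace-free part differ by an element of k; nonzero integers have house
  -- at least 1, which is the separation.
  have hFib : ∀ w ∈ T.image fun x => (t x : K),
      ((T.filter fun x => (t x : K) = w).card : ℝ) ≤ (1 + 2 * (2 * (l₂ / 7)) / 1) ^ finrank ℚ k := by
    intro w hw
    obtain ⟨x₀, hx₀, rfl⟩ := Finset.mem_image.1 hw
    have hc : ((T.filter fun x => (t x : K) = t x₀).image fun x : 𝓞 K => ((x : K) - x₀)).card =
        (T.filter fun x => (t x : K) = t x₀).card :=
      Finset.card_image_of_injective _ fun x y h => hcoe (sub_left_injective h)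
    rw [← hc]
    refine card_le_of_separated_of_house_le (k := k) (1 : K) _ (by positivity) one_pos ?_ ?_ ?_
    · intro z hz
      obtain ⟨x, hx, rfl⟩ := Finset.mem_image.1 hz
      obtain ⟨hx, hx'⟩ := Finset.mem_filter.1 hx
      rw [ht, ht] at hx'
      refine ⟨(Algebra.trace k K (x : K) - Algebra.trace k K (x₀ : K)) / 3, ?_⟩
      rw [map_div₀, map_sub, map_ofNat]
      field_simp
      linear_combination hx'
    · intro z hz
      obtain ⟨x, hx, rfl⟩ := Finset.mem_image.1 hz
      have := house_sub_le (x : K) x₀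
      linarith [hT x (Finset.mem_filter.1 hx).1, hT x₀ hx₀]
    · intro z hz w hw hzw
      obtain ⟨x, hx, rfl⟩ := Finset.mem_image.1 hz
      obtain ⟨y, hy, rfl⟩ := Finset.mem_image.1 hw
      refine one_le_house_of_isIntegral ((x.2.sub x₀.2).sub (y.2.sub x₀.2)) (sub_ne_zero.2 hzw)
  have hcard : (T.card : ℝ) ≤ (3 * (l₂ / l₁)) ^ finrank ℚ k * (2 * l₂) ^ finrank ℚ k := by
    rw [Finset.card_eq_sum_card_image (fun x => (t x : K)) T]
    push_cast
    calc _ ≤ ∑ w ∈ T.image fun x => (t x : K), (1 + 2 * (2 * (l₂ / 7)) / 1) ^ finrank ℚ k :=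
          Finset.sum_le_sum hFib
      _ = (T.image fun x => (t x : K)).card * (1 + 2 * (2 * (l₂ / 7)) / 1) ^ finrank ℚ k := by
          rw [Finset.sum_const, nsmul_eq_mul]
      _ ≤ _ := by
          have h1 : 1 ≤ l₂ / l₁ := (one_le_div hl₁).2 hle
          refine mul_le_mul (hIm.trans ?_) ?_ (by positivity) (by positivity)
          · refine pow_le_pow_left₀ (by positivity) ?_ _
            have : 2 * (6 * (l₂ / 7)) / l₁ = 12 / 7 * (l₂ / l₁) := by ring
            linarith
          · refine pow_le_pow_left₀ (by positivity) ?_ _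
            linarith
  have hfin : finrank ℚ K = 3 * finrank ℚ k := by
    rw [← finrank_mul_finrank ℚ k K, h3, mul_comm]
  rw [hfin, pow_mul] at hvol
  have hs : 0 ≤ √|(discr K : ℝ)| := Real.sqrt_nonneg _
  have h5 : ((l₂ / 14) ^ 3) ^ finrank ℚ k ≤
      (3 * (l₂ / l₁) * (2 * l₂)) ^ finrank ℚ k * √|(discr K : ℝ)| := by
    rw [mul_pow (3 * (l₂ / l₁))]
    exact hvol.trans (mul_le_mul_of_nonneg_right hcard hs)
  have h6 : l₁ * l₂ = (6 * 14 ^ 3) * ((l₂ / 14) ^ 3 / (3 * (l₂ / l₁) * (2 * l₂))) := by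
    field_simp
    ring
  rw [h6, mul_pow, div_pow]
  gcongr
  rw [div_le_iff₀ (by positivity), mul_comm]
  exact h5

end ReducedPair

/-! ### Discriminants of families of elements -/

section Discriminant

open Module

variable {F : Type*} [Field F] [NumberField F] {ι : Type*} [Fintype ι] [DecidableEq ι]

/-- The discriminant of a family of integers is a square times the discriminant of the field. -/
theorem exists_discr_eq_sq_mul (hι : Fintype.card ι = finrank ℚ F) (c : ι → 𝓞 F) :
    ∃ m : ℤ, Algebra.discr ℚ (fun i => (c i : F)) = (m : ℚ) ^ 2 * (discr F : ℚ) := by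
  have hc : Fintype.card (Free.ChooseBasisIndex ℤ (𝓞 F)) = Fintype.card ι := by
    rw [hι, ← finrank_eq_card_basis (integralBasis F)]
  let e := Fintype.equivOfCardEq hc
  let b := (integralBasis F).reindex e
  let P : Matrix ι ι ℤ := .of fun i j => (RingOfIntegers.basis F).repr (c i) (e.symm j)
  have h1 : (fun i => (c i : F)) =
      Matrix.mulVec ((P.map (Int.castRingHom ℚ)).map (algebraMap ℚ F)) b := by
    ext i
    conv_lhs => rw [← (RingOfIntegers.basis F).sum_repr (c i)]
    rw [RingOfIntegers.coe_eq_algebraMap, map_sum, ← e.symm.sum_comp]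
    refine Finset.sum_congr rfl fun j _ => ?_
    simp [P, b, integralBasis_apply]
  have h2 : Algebra.discr ℚ b = (discr F : ℚ) := by
    rw [coe_discr, ← Algebra.discr_reindex ℚ (integralBasis F) e, Basis.coe_reindex]
  refine ⟨P.det, ?_⟩
  rw [h1, Algebra.discr_of_matrix_mulVec, h2]
  congr 2
  exact (RingHom.map_det (Int.castRingHom ℚ) P).symm

/-- The discriminant is the square of the determinant of the embeddings matrix; each Leibniz term
contains every element exactly once. -/
theorem abs_discr_le_of_house_le (hι : Fintype.card ι = finrank ℚ F) (c : ι → F) (h : ι → ℝ)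
    (hc : ∀ i, house (c i) ≤ h i) :
    |((Algebra.discr ℚ c : ℚ) : ℝ)| ≤ ((Fintype.card ι).factorial * ∏ i, h i) ^ 2 := by
  have hcard : Fintype.card ι = Fintype.card (F →ₐ[ℚ] ℂ) := by rw [hι, AlgHom.card]
  let e := Fintype.equivOfCardEq hcard
  have h1 := Algebra.discr_eq_det_embeddingsMatrixReindex_pow_two ℚ ℂ c e
  have h2 : ‖(Algebra.embeddingsMatrixReindex ℚ ℂ c e).det‖ ≤
      (Fintype.card ι).factorial * ∏ i, h i := by
    rw [Matrix.det_apply]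
    calc _ ≤ ∑ σ : Equiv.Perm ι, ∏ i, h i := by
          refine norm_sum_le_of_le _ fun σ _ => ?_
          rw [← Equiv.prod_comp σ h]
          have : ‖(Equiv.Perm.sign σ • ∏ i, Algebra.embeddingsMatrixReindex ℚ ℂ c e (σ i) i)‖ =
              ‖∏ i, Algebra.embeddingsMatrixReindex ℚ ℂ c e (σ i) i‖ := by
            rcases Int.units_eq_one_or (Equiv.Perm.sign σ) with h | h <;> simp [h]
          rw [this, norm_prod]
          refine Finset.prod_le_prod (fun _ _ => norm_nonneg _) fun i _ => ?_
          exact (norm_embedding_le_house (c (σ i)) ((e i : F →ₐ[ℚ] ℂ) : F →+* ℂ)).trans (hc _)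
      _ = _ := by
          rw [Finset.sum_const, Finset.card_univ, Fintype.card_perm, nsmul_eq_mul]
  have h3 : |((Algebra.discr ℚ c : ℚ) : ℝ)| =
      ‖(Algebra.embeddingsMatrixReindex ℚ ℂ c e).det‖ ^ 2 := by
    rw [← norm_pow, ← h1, eq_ratCast, Complex.norm_ratCast]
  rw [h3]
  exact pow_le_pow_left₀ (norm_nonneg _) h2 2

/-- Cramer's rule: the transition matrix is the identity with column i replaced by the coordinates
of x, and its determinant is the i-th coordinate. -/
theorem discr_update_basis (b : Basis ι ℚ F) (i : ι) (x : F) :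
    Algebra.discr ℚ (Function.update b i x) = b.repr x i ^ 2 * Algebra.discr ℚ b := by
  let P : Matrix ι ι ℚ := (1 : Matrix ι ι ℚ).updateCol i (b.repr x)
  have h1 : Function.update b i x = Matrix.vecMul b (P.map (algebraMap ℚ F)) := by
    ext j
    by_cases hj : j = i
    · subst hj
      rw [Function.update_self]
      conv_lhs => rw [← b.sum_repr x]
      refine Finset.sum_congr rfl fun l _ => ?_
      simp [P, Algebra.smul_def, mul_comm]
    · rw [Function.update_of_ne hj]
      simp [P, Matrix.vecMul, dotProduct, Matrix.updateCol_ne hj, Matrix.one_apply, apply_ite]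
  rw [h1, Algebra.discr_of_matrix_vecMul]
  congr 2
  have := congrFun (congrFun (congrArg DFunLike.coe (Matrix.cramer_one (n := ι) (α := ℚ)))
    (b.repr x)) i
  rwa [Matrix.cramer_apply] at this

end Discriminant

/-! ### Integral coordinates in a nearly reduced basis -/

section Coordinates

open Module

variable (k : Type*) [Field k] [NumberField k]

theorem linearIndependent_one_pair {k K : Type*} [Field k] [Field K] [Algebra k K] {α β : K}
    (hα : ∀ x : k, α ≠ algebraMap k K x)
    (hβ : ∀ x y : k, β ≠ algebraMap k K x + algebraMap k K y * α) :
    LinearIndependent k ![1, α, β] := by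
  rw [Fintype.linearIndependent_iff]
  intro g hg
  simp only [Fin.sum_univ_three, Matrix.cons_val_zero, Matrix.cons_val_one, Matrix.cons_val,
    Algebra.smul_def, mul_one] at hg
  have h2 : g 2 = 0 := by
    by_contra h
    have h' : algebraMap k K (g 2) ≠ 0 := by simpa using h
    refine hβ (-(g 0 / g 2)) (-(g 1 / g 2)) ?_
    rw [map_neg, map_neg, map_div₀, map_div₀]
    field_simp
    linear_combination hg
  rw [h2, map_zero, zero_mul, add_zero] at hg
  have h1 : g 1 = 0 := by
    by_contra h
    have h' : algebraMap k K (g 1) ≠ 0 := by simpa using h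
    refine hα (-(g 0 / g 1)) ?_
    rw [map_neg, map_div₀]
    field_simp
    linear_combination hg
  rw [h1, map_zero, zero_mul, add_zero] at hg
  intro i
  fin_cases i
  · simpa using hg
  · exact h1
  · exact h2

/-- If `1, α, β` are almost a reduced basis of `𝓞 K`, then every integer `x` of `K` has, up to a
bounded denominator, integral coordinates of the size predicted by the house of `x`. -/
theorem exists_bounded_coordinates (C₀ : ℝ) (hC₀ : 1 ≤ C₀) : ∃ N : ℕ, 0 < N ∧ ∃ C : ℝ, 1 ≤ C ∧
    ∀ (K : Type*) [Field K] [NumberField K] [Algebra k K], finrank k K = 3 →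
    ∀ α β : 𝓞 K, (∀ x : k, (α : K) ≠ algebraMap k K x) →
    (∀ x y : k, (β : K) ≠ algebraMap k K x + algebraMap k K y * α) →
    1 ≤ house (α : K) → 1 ≤ house (β : K) →
    (house (α : K) * house (β : K)) ^ finrank ℚ k ≤ C₀ ^ finrank ℚ k * √|(discr K : ℝ)| →
    ∀ x : 𝓞 K, ∃ y₀ y₁ y₂ : 𝓞 k,
      (N : K) * x = algebraMap k K y₀ + algebraMap k K y₁ * α + algebraMap k K y₂ * β ∧
      house (y₁ : k) * house (α : K) ≤ C * house (x : K) ∧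
      house (y₂ : k) * house (β : K) ≤ C * house (x : K) := by
  classical
  let n := finrank ℚ k
  let ω := integralBasis k
  let H : ℝ := 1 + ∑ i, house (ω i)
  have hω : ∀ i, house (ω i) ≤ H := fun i => by
    have := Finset.single_le_sum (f := fun i => house (ω i)) (fun _ _ => house_nonneg _)
      (Finset.mem_univ i)
    simp only [H]
    linarith
  have hH : 1 ≤ H := by
    have : 0 ≤ ∑ i, house (ω i) := Finset.sum_nonneg fun _ _ => house_nonneg _
    simp only [H]
    linarith
  let D : ℝ := (n * 3).factorial * (H ^ (n * 3) * C₀ ^ n)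
  have hD : 1 ≤ D := by
    have h1 : (1 : ℝ) ≤ (n * 3).factorial := by exact_mod_cast (n * 3).factorial_pos
    have h2 : 1 ≤ H ^ (n * 3) := one_le_pow₀ hH
    have h3 : 1 ≤ C₀ ^ n := one_le_pow₀ hC₀
    exact one_le_mul_of_one_le_of_one_le h1 (one_le_mul_of_one_le_of_one_le h2 h3)
  -- D will bound the index in 𝓞 K of the lattice spanned by the products of the two bases. The
  -- factorial is a common multiple of all admissible indices, so it does not depend on K.
  let N := (⌊D⌋₊).factorial
  have hn : 1 ≤ n := finrank_pos
  refine ⟨N, Nat.factorial_pos _, N * (n * (D * H)), ?_, ?_⟩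
  · have h1 : (1 : ℝ) ≤ N := by exact_mod_cast Nat.factorial_pos _
    have h2 : (1 : ℝ) ≤ n := by exact_mod_cast hn
    exact one_le_mul_of_one_le_of_one_le h1 (one_le_mul_of_one_le_of_one_le h2
      (one_le_mul_of_one_le_of_one_le hD hH))
  intro K _ _ _ h3 α β hα hβ hα1 hβ1 hvol x
  have hcardn : Fintype.card (Free.ChooseBasisIndex ℤ (𝓞 k)) = n :=
    (finrank_eq_card_basis ω).symm
  let c : Basis (Fin 3) k K := basisOfLinearIndependentOfCardEqFinrank
    (linearIndependent_one_pair hα hβ) (by simp [h3])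
  have hc : ⇑c = ![1, (α : K), (β : K)] := coe_basisOfLinearIndependentOfCardEqFinrank _ _
  let B := ω.smulTower c
  let l : Fin 3 → ℝ := ![1, house (α : K), house (β : K)]
  have hl : ∀ j, 1 ≤ l j := by
    intro j
    fin_cases j
    · exact le_rfl
    · exact hα1
    · exact hβ1
  have hcl : ∀ j, house (c j) ≤ l j := by
    intro j
    rw [hc]
    fin_cases j
    · have := house_intCast (K := K) 1
      simp only [Int.cast_one, abs_one] at this
      exact this.le
    · exact le_rfl
    · exact le_rfl
  let h : Free.ChooseBasisIndex ℤ (𝓞 k) × Fin 3 → ℝ := fun ij => H * l ij.2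
  have hh1 : ∀ ij, 1 ≤ h ij := fun ij => one_le_mul_of_one_le_of_one_le hH (hl _)
  have hBh : ∀ ij, house (B ij) ≤ h ij := by
    intro ij
    rw [Basis.smulTower_apply, Algebra.smul_def]
    refine (house_mul_le _ _).trans (mul_le_mul ((house_algebraMap_le _).trans (hω _)) (hcl _)
      (house_nonneg _) (by linarith))
  have hcard : Fintype.card (Free.ChooseBasisIndex ℤ (𝓞 k) × Fin 3) = n * 3 := by
    rw [Fintype.card_prod, hcardn, Fintype.card_fin]
  have hcardK : Fintype.card (Free.ChooseBasisIndex ℤ (𝓞 k) × Fin 3) = finrank ℚ K := by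
    rw [hcard, ← finrank_mul_finrank ℚ k K, h3]
  have hprod : ∏ ij, h ij = H ^ (n * 3) * (house (α : K) * house (β : K)) ^ n := by
    simp only [h, Finset.prod_mul_distrib, Finset.prod_const, Finset.card_univ, hcard]
    rw [Fintype.prod_prod_type]
    simp [l, Fin.prod_univ_three, hcardn]
  set S := √|(discr K : ℝ)| with hS
  have hS0 : 0 < S := by
    rw [hS, Real.sqrt_pos, abs_pos]
    exact_mod_cast discr_ne_zero K
  have hSsq : S ^ 2 = |(discr K : ℝ)| := Real.sq_sqrt (abs_nonneg _)
  have hbound : (n * 3).factorial * ∏ ij, h ij ≤ D * S := by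
    rw [hprod]
    calc _ ≤ ((n * 3).factorial : ℝ) * (H ^ (n * 3) * (C₀ ^ n * S)) := by gcongr
      _ = _ := by simp only [D]; ring
  have hBint : ∀ ij, ∃ z : 𝓞 K, (z : K) = B ij := by
    rintro ⟨i, j⟩
    have h1 : IsIntegral ℤ (ω i) := by
      rw [integralBasis_apply]; exact (RingOfIntegers.basis k i).2
    have h2 : IsIntegral ℤ (c j) := by
      rw [hc]
      fin_cases j
      · exact isIntegral_one
      · exact α.2
      · exact β.2
    have h4 : IsIntegral ℤ (B (i, j)) := by
      rw [Basis.smulTower_apply, Algebra.smul_def]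
      exact (h1.map (algebraMap k K).toIntAlgHom).mul h2
    exact ⟨⟨_, h4⟩, rfl⟩
  choose z hz using hBint
  obtain ⟨m, hm⟩ := exists_discr_eq_sq_mul hcardK z
  rw [show (fun i => (z i : K)) = B from funext hz] at hm
  have hdiscB := Algebra.discr_not_zero_of_basis ℚ B
  have hm0 : m ≠ 0 := by
    rintro rfl
    exact hdiscB (by rw [hm]; simp)
  have hmR : |((Algebra.discr ℚ B : ℚ) : ℝ)| = ((|m| : ℤ) * S) ^ 2 := by
    rw [hm, mul_pow, hSsq]
    push_cast
    rw [abs_mul, abs_pow]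
  -- The square root of |disc B| equals |m|·S, while the houses bound it by D·S; the factor S
  -- cancels.
  have hmD : ((|m| : ℤ) : ℝ) ≤ D := by
    have h1 := abs_discr_le_of_house_le hcardK B h hBh
    rw [hmR, hcard] at h1
    have hp : 0 ≤ ∏ ij, h ij := Finset.prod_nonneg fun ij _ => by linarith [hh1 ij]
    have h2 := (pow_le_pow_iff_left₀ (by positivity) (by positivity) two_ne_zero).1 h1
    exact le_of_mul_le_mul_right (h2.trans hbound) hS0
  have hmN : m ∣ (N : ℤ) := by
    rw [← Int.natAbs_dvd, Int.natCast_dvd_natCast]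
    refine Nat.dvd_factorial (Int.natAbs_pos.2 hm0) (Nat.le_floor ?_)
    rwa [← Int.natCast_natAbs, Int.cast_natCast] at hmD
  have hupd : ∀ ij, Algebra.discr ℚ (Function.update B ij (x : K)) =
      B.repr x ij ^ 2 * Algebra.discr ℚ B := fun ij => discr_update_basis B ij x
  -- Replacing a basis vector by x again gives a family of integers, so (coordinate · m)² is the
  -- square of an integer m'. Hence coordinate · m = ±m', and m divides N.
  have hrepr : ∀ ij, ∃ r : ℤ, (N : ℚ) * B.repr x ij = r := by
    intro ij
    obtain ⟨m', hm'⟩ := exists_discr_eq_sq_mul hcardK (Function.update z ij x)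
    have h1 : (fun i => (Function.update z ij x i : K)) = Function.update B ij (x : K) := by
      ext i
      by_cases hi : i = ij
      · subst hi; simp
      · simp [Function.update_of_ne hi, hz]
    rw [h1, hupd, hm] at hm'
    have hd : (discr K : ℚ) ≠ 0 := by exact_mod_cast discr_ne_zero K
    have h2 : (B.repr x ij * m) ^ 2 = (m' : ℚ) ^ 2 := by
      apply mul_right_cancel₀ hd
      rw [← hm']
      ring
    obtain ⟨t, ht⟩ := hmN
    have ht' : (N : ℚ) = m * t := by exact_mod_cast ht
    rcases sq_eq_sq_iff_eq_or_eq_neg.1 h2 with h2 | h2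
    · exact ⟨m' * t, by push_cast; rw [ht', ← h2]; ring⟩
    · exact ⟨-m' * t, by push_cast; rw [ht', ← h2]; ring⟩
  -- Cramer's rule again, now for size: in the determinant bound, the house of x takes the place of
  -- the factor `h ij`.
  have hsize : ∀ ij, |((B.repr x ij : ℚ) : ℝ)| * l ij.2 ≤ D * house (x : K) := by
    intro ij
    have h1 := abs_discr_le_of_house_le hcardK (Function.update B ij (x : K))
      (Function.update h ij (house (x : K))) (by
        intro i
        by_cases hi : i = ij
        · subst hi; simp
        · simp [Function.update_of_ne hi, hBh])
    rw [hupd, Rat.cast_mul, abs_mul, hmR, hcard, Rat.cast_pow, abs_pow, ← mul_pow,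
      Finset.prod_update_of_mem (Finset.mem_univ _)] at h1
    have hp : 0 ≤ ∏ i ∈ Finset.univ \ {ij}, h i :=
      Finset.prod_nonneg fun i _ => by linarith [hh1 i]
    have hx0 := house_nonneg (x : K)
    have h2 := (pow_le_pow_iff_left₀ (by positivity) (by positivity) two_ne_zero).1 h1
    have h4 : ∏ i, h i = h ij * ∏ i ∈ Finset.univ \ {ij}, h i := by
      rw [Finset.sdiff_singleton_eq_erase, Finset.mul_prod_erase _ _ (Finset.mem_univ _)]
    have hm1 : (1 : ℝ) ≤ (|m| : ℤ) := by exact_mod_cast Int.one_le_abs hm0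
    have hl0 : 0 ≤ l ij.2 := by linarith [hl ij.2]
    refine le_of_mul_le_mul_right ?_ hS0
    calc |((B.repr x ij : ℚ) : ℝ)| * l ij.2 * S
        = l ij.2 * (|((B.repr x ij : ℚ) : ℝ)| * (1 * S)) := by ring
      _ ≤ h ij * (|((B.repr x ij : ℚ) : ℝ)| * ((|m| : ℤ) * S)) := by
          refine mul_le_mul ?_ (by gcongr) (by positivity) (by linarith [hh1 ij])
          exact le_mul_of_one_le_left hl0 hH
      _ ≤ h ij * ((n * 3).factorial * (house (x : K) * ∏ i ∈ Finset.univ \ {ij}, h i)) :=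
          mul_le_mul_of_nonneg_left h2 (by linarith [hh1 ij])
      _ = house (x : K) * ((n * 3).factorial * ∏ i, h i) := by rw [h4]; ring
      _ ≤ house (x : K) * (D * S) := mul_le_mul_of_nonneg_left hbound hx0
      _ = _ := by ring
  choose r hr using hrepr
  let y : Fin 3 → 𝓞 k := fun j => ∑ i, r (i, j) • RingOfIntegers.basis k i
  have hy : ∀ j, (y j : k) = (N : k) * c.repr x j := by
    intro j
    conv_rhs => rw [← ω.sum_repr (c.repr x j)]
    simp only [y, RingOfIntegers.coe_eq_algebraMap, map_sum, Finset.mul_sum]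
    refine Finset.sum_congr rfl fun i _ => ?_
    have h1 := hr (i, j)
    rw [Basis.smulTower_repr_mk] at h1
    have h2 : ((r (i, j) : ℚ) : k) = (N : k) * ((ω.repr (c.repr x j) i : ℚ) : k) := by
      rw [← h1]; push_cast; rfl
    rw [Algebra.smul_def (A := k), eq_ratCast, ← mul_assoc]
    refine Eq.trans ?_ (congrArg (· * ω i) h2)
    simp [ω, integralBasis_apply]
  have hyl : ∀ j, house (y j : k) * l j ≤ N * (n * (D * H)) * house (x : K) := by
    intro j
    have hl0 : 0 ≤ l j := by linarith [hl j]
    have h1 : house (y j : k) ≤ ∑ i, |(r (i, j) : ℝ)| * H := by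
      simp only [y, map_sum]
      refine (house_sum_le_sum_house _ _).trans (Finset.sum_le_sum fun i _ => ?_)
      rw [zsmul_eq_mul, map_mul, map_intCast]
      refine (house_mul_le _ _).trans ?_
      rw [house_intCast, ← integralBasis_apply]
      push_cast
      exact mul_le_mul_of_nonneg_left (hω i) (abs_nonneg _)
    calc _ ≤ (∑ i, |(r (i, j) : ℝ)| * H) * l j := mul_le_mul_of_nonneg_right h1 hl0
      _ = ∑ i, (|(r (i, j) : ℝ)| * l j) * H := by
          rw [Finset.sum_mul]; exact Finset.sum_congr rfl fun _ _ => by ring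
      _ ≤ ∑ i : Free.ChooseBasisIndex ℤ (𝓞 k), (N * (D * house (x : K))) * H := by
          refine Finset.sum_le_sum fun i _ => mul_le_mul_of_nonneg_right ?_ (by linarith)
          have h2 : (r (i, j) : ℝ) = N * ((B.repr x (i, j) : ℚ) : ℝ) := by
            have := hr (i, j)
            exact_mod_cast this.symm
          rw [h2, abs_mul, Nat.abs_cast, mul_assoc]
          exact mul_le_mul_of_nonneg_left (hsize (i, j)) (Nat.cast_nonneg _)
      _ = _ := by
          rw [Finset.sum_const, Finset.card_univ, hcardn, nsmul_eq_mul]; ring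
  refine ⟨y 0, y 1, y 2, ?_, hyl 1, hyl 2⟩
  have h5 := c.sum_repr (x : K)
  rw [Fin.sum_univ_three, hc] at h5
  simp only [Matrix.cons_val_zero, Matrix.cons_val_one, Matrix.cons_val, Algebra.smul_def,
    mul_one] at h5
  rw [hy, hy, hy, map_mul, map_mul, map_mul, map_natCast]
  conv_lhs => rw [← h5]
  ring

end Coordinates

/-! ### The Delone–Faddeev cubic of a cubic extension -/

section CubicForm

open Module

/-- In a normalised basis `1, A, B` with `AB ∈ k`, associativity forces the Delone–Faddeev
multiplication table. -/
theorem cubic_relation_of_normalized {k K : Type*} [Field k] [Field K] [Algebra k K] {A B : K}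
    (hli : LinearIndependent k ![1, A, B]) {a b c d u u' e : k}
    (hAB : A * B = algebraMap k K e)
    (hA : A ^ 2 = algebraMap k K u + algebraMap k K b * A - algebraMap k K a * B)
    (hB : B ^ 2 = algebraMap k K u' + algebraMap k K d * A - algebraMap k K c * B) :
    A ^ 3 - algebraMap k K b * A ^ 2 + algebraMap k K (a * c) * A - algebraMap k K (a ^ 2 * d) = 0
    := by
  rw [Fintype.linearIndependent_iff] at hli
  -- These are the coordinates of A²·B - A·(AB), which vanishes by associativity.
  have h := hli ![b * e - a * u', -(a * d + e), u + a * c] (by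
    simp only [Fin.sum_univ_three, Matrix.cons_val_zero, Matrix.cons_val_one, Matrix.cons_val,
      Algebra.smul_def, mul_one, map_sub, map_add, map_mul, map_neg]
    linear_combination (-algebraMap k K b + A) * hAB - B * hA + algebraMap k K a * hB)
  have h1 : e = -(a * d) := by
    have := h 1
    simp only [Matrix.cons_val_one, Matrix.cons_val_zero] at this
    linear_combination -this
  have h2 : u = -(a * c) := by
    have := h 2
    simp only [Matrix.cons_val] at this
    linear_combination this
  rw [h1] at hAB
  rw [h2] at hA
  simp only [map_neg, map_mul, map_pow] at hAB hA ⊢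
  linear_combination A * hA - algebraMap k K a * hAB

theorem not_mem_of_shift {k K : Type*} [Field k] [Field K] [Algebra k K] [CharZero k] {α β : K}
    (hα : ∀ x : k, α ≠ algebraMap k K x)
    (hβ : ∀ x y : k, β ≠ algebraMap k K x + algebraMap k K y * α) {N : ℕ} (hN : 0 < N) (v w : k) :
    (∀ x : k, (N : K) * α - algebraMap k K w ≠ algebraMap k K x) ∧
    (∀ x y : k, (N : K) * β - algebraMap k K v ≠
      algebraMap k K x + algebraMap k K y * ((N : K) * α - algebraMap k K w)) := by
  have hNk : (N : k) ≠ 0 := by exact_mod_cast hN.ne'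
  have hNK : (N : K) ≠ 0 := by
    rw [← map_natCast (algebraMap k K)]
    exact (map_ne_zero _).2 hNk
  constructor
  · intro x hx
    refine hα ((x + w) / N) ?_
    rw [map_div₀, map_natCast, map_add]
    field_simp
    linear_combination hx
  · intro x y hxy
    refine hβ ((x + v - y * w) / N) y ?_
    rw [map_div₀, map_natCast, map_sub, map_add, map_mul]
    field_simp
    linear_combination hxy

theorem natDegree_minpoly_eq_three {k K : Type*} [Field k] [Field K] [Algebra k K]
    (h3 : finrank k K = 3) {α : K} (hα : ∀ x : k, α ≠ algebraMap k K x) :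
    (minpoly k α).natDegree = 3 := by
  have : FiniteDimensional k K := Module.finite_of_finrank_pos (by omega)
  have h1 := minpoly.degree_dvd (Algebra.IsIntegral.isIntegral (R := k) α)
  rw [h3] at h1
  rcases (Nat.dvd_prime Nat.prime_three).1 h1 with h | h
  · obtain ⟨x, hx⟩ := minpoly.natDegree_eq_one_iff.1 h
    exact absurd hx.symm (hα x)
  · exact h

open Polynomial in
theorem quadratic_ne_zero_of_finrank_eq_three {k K : Type*} [Field k] [Field K] [Algebra k K]
    (h3 : finrank k K = 3) {α : K} (hα : ∀ x : k, α ≠ algebraMap k K x) {r : k} (hr : r ≠ 0)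
    (s t : k) : algebraMap k K r * (α * α) + algebraMap k K s * α + algebraMap k K t ≠ 0 := by
  intro h
  have h0 : (C r * X ^ 2 + C s * X + C t : k[X]) ≠ 0 := fun h => by
    have := natDegree_quadratic (b := s) (c := t) hr
    rw [h] at this
    simp at this
  have h1 := natDegree_le_of_dvd (minpoly.dvd k α (p := C r * X ^ 2 + C s * X + C t)
    (by simpa [sq] using h)) h0
  rw [natDegree_minpoly_eq_three h3 hα, natDegree_quadratic hr] at h1
  omega

/-- Every cubic extension of `k` is generated by a root of a cubic polynomial
`a x³ - b x² + c x - d` over `𝓞 k` with well-controlled coefficients. -/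
theorem exists_cubic_form (k : Type*) [Field k] [NumberField k] : ∃ C : ℝ, 1 ≤ C ∧
    ∀ (K : Type*) [Field K] [NumberField K] [Algebra k K], finrank k K = 3 →
    ∃ l₁ l₂ : ℝ, 1 ≤ l₁ ∧ l₁ ≤ l₂ ∧ (l₁ * l₂) ^ finrank ℚ k ≤ C * √|(discr K : ℝ)| ∧
    ∃ (a b c d : 𝓞 k) (A : 𝓞 K), a ≠ 0 ∧ (∀ x : k, (A : K) ≠ algebraMap k K x) ∧
      (A : K) ^ 3 - algebraMap k K b * (A : K) ^ 2 + algebraMap k K (a * c) * (A : K) -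
        algebraMap k K (a ^ 2 * d) = 0 ∧
      house (a : k) * l₂ ≤ C * l₁ ^ 2 ∧ house (b : k) ≤ C * l₁ ∧ house (c : k) ≤ C * l₂ ∧
      house (d : k) * l₁ ≤ C * l₂ ^ 2 := by
  obtain ⟨N, hN, C, hC, key⟩ := exists_bounded_coordinates k (6 * 14 ^ 3) (by norm_num)
  refine ⟨3 * C + (6 * 14 ^ 3) ^ finrank ℚ k, ?_, ?_⟩
  · have : (0 : ℝ) ≤ (6 * 14 ^ 3) ^ finrank ℚ k := by positivity
    linarith
  intro K _ _ _ h3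
  obtain ⟨α, β, hα, hβ, hα1, hαβ, hvol⟩ := exists_reduced_pair (k := k) (K := K) h3
  have hβ1 := hα1.trans hαβ
  have key' := key K h3 α β hα hβ hα1 hβ1 hvol
  set l₁ := house (α : K) with hl₁
  set l₂ := house (β : K) with hl₂
  have hp₁ : 0 < l₁ := by linarith
  have hp₂ : 0 < l₂ := by linarith
  set C' := 3 * C + (6 * 14 ^ 3) ^ finrank ℚ k with hC'
  have hCC : 3 * C ≤ C' := by
    have : (0 : ℝ) ≤ (6 * 14 ^ 3) ^ finrank ℚ k := by positivity
    linarith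
  obtain ⟨u₁, v₁, w₁, e₁, hv₁, hw₁⟩ := key' (α * α)
  obtain ⟨u₂, v₂, w₂, e₂, hv₂, hw₂⟩ := key' (α * β)
  obtain ⟨u₃, v₃, w₃, e₃, hv₃, hw₃⟩ := key' (β * β)
  rw [RingOfIntegers.coe_eq_algebraMap, map_mul] at e₁ e₂ e₃
  have s₁ : house ((α * α : 𝓞 K) : K) ≤ l₁ * l₁ := by
    rw [RingOfIntegers.coe_eq_algebraMap, map_mul]; exact house_mul_le _ _
  have s₂ : house ((α * β : 𝓞 K) : K) ≤ l₁ * l₂ := by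
    rw [RingOfIntegers.coe_eq_algebraMap, map_mul]; exact house_mul_le _ _
  have s₃ : house ((β * β : 𝓞 K) : K) ≤ l₂ * l₂ := by
    rw [RingOfIntegers.coe_eq_algebraMap, map_mul]; exact house_mul_le _ _
  have hC0 : 0 ≤ C := by linarith
  have t₁ := mul_le_mul_of_nonneg_left s₁ hC0
  have t₂ := mul_le_mul_of_nonneg_left s₂ hC0
  have t₃ := mul_le_mul_of_nonneg_left s₃ hC0
  have bv₁ : house (v₁ : k) ≤ C * l₁ := le_of_mul_le_mul_right (by linarith) hp₁
  have bw₂ : house (w₂ : k) ≤ C * l₁ := le_of_mul_le_mul_right (by linarith) hp₂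
  have bv₂ : house (v₂ : k) ≤ C * l₂ := le_of_mul_le_mul_right (by linarith) hp₁
  have bw₃ : house (w₃ : k) ≤ C * l₂ := le_of_mul_le_mul_right (by linarith) hp₂
  have hw2 : IsIntegral ℤ (algebraMap k K w₂) := w₂.2.map (algebraMap k K).toIntAlgHom
  -- With B = Nβ - v₂, this shift removes the linear part of the product: AB = N u₂ + v₂ w₂ lies in
  -- k.
  obtain ⟨A, hA⟩ : ∃ A : 𝓞 K, (A : K) = (N : K) * α - algebraMap k K w₂ :=
    by
    obtain ⟨w, hw⟩ : ∃ w : 𝓞 K, (w : K) = algebraMap k K w₂ := ⟨⟨_, hw2⟩, rfl⟩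
    exact ⟨N * α - w, by rw [← hw]; simp⟩
  obtain ⟨hA1, hB1⟩ := not_mem_of_shift hα hβ hN (v₂ : k) (w₂ : k)
  have hrel := cubic_relation_of_normalized (linearIndependent_one_pair hA1 hB1)
    (a := -(w₁ : k)) (b := (v₁ : k) - 2 * w₂) (c := 2 * (v₂ : k) - w₃) (d := (v₃ : k))
    (e := N * u₂ + v₂ * w₂) (u := N * u₁ + v₁ * w₂ + w₁ * v₂ - w₂ ^ 2)
    (u' := N * u₃ + v₃ * w₂ + w₃ * v₂ - v₂ ^ 2)
    (by simp only [map_add, map_mul, map_natCast]; linear_combination (N : K) * e₂)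
    (by
      simp only [map_add, map_mul, map_natCast, map_sub, map_neg, map_pow, map_ofNat]
      linear_combination (N : K) * e₁)
    (by
      simp only [map_add, map_mul, map_natCast, map_sub, map_pow, map_ofNat]
      linear_combination (N : K) * e₃)
  rw [← hA] at hrel
  -- Otherwise α would satisfy a quadratic equation over k.
  have ha0 : w₁ ≠ 0 := by
    rintro rfl
    have hNk : (N : k) ≠ 0 := by exact_mod_cast hN.ne'
    refine quadratic_ne_zero_of_finrank_eq_three h3 hα hNk (-(v₁ : k)) (-(u₁ : k)) ?_
    simp only [map_zero, zero_mul, add_zero] at e₁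
    simp only [map_natCast, map_neg]
    linear_combination e₁
  refine ⟨l₁, l₂, hα1, hαβ, ?_, -w₁, v₁ - 2 * w₂, 2 * v₂ - w₃, v₃, A, neg_ne_zero.2 ha0,
    fun x => hA ▸ hA1 x, ?_, ?_, ?_, ?_, ?_⟩
  · refine hvol.trans (mul_le_mul_of_nonneg_right ?_ (Real.sqrt_nonneg _))
    linarith
  · simpa only [RingOfIntegers.coe_eq_algebraMap, map_sub, map_mul, map_ofNat, map_neg,
      map_pow] using hrel
  · have : house ((-w₁ : 𝓞 k) : k) = house (w₁ : k) := by
      rw [RingOfIntegers.coe_eq_algebraMap, map_neg, house_neg]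
    rw [this]
    nlinarith [sq_nonneg l₁]
  · have h1 : house ((v₁ - 2 * w₂ : 𝓞 k) : k) ≤ house (v₁ : k) + 2 * house (w₂ : k) := by
      have := house_sub_le (v₁ : k) ((2 : ℕ) * (w₂ : k))
      rw [house_nat_mul] at this
      simpa only [RingOfIntegers.coe_eq_algebraMap, map_sub, map_mul, map_ofNat,
        Nat.cast_ofNat] using this
    have := mul_le_mul_of_nonneg_right hCC hp₁.le
    linarith
  · have h1 : house ((2 * v₂ - w₃ : 𝓞 k) : k) ≤ 2 * house (v₂ : k) + house (w₃ : k) := by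
      have := house_sub_le ((2 : ℕ) * (v₂ : k)) (w₃ : k)
      rw [house_nat_mul] at this
      simpa only [RingOfIntegers.coe_eq_algebraMap, map_sub, map_mul, map_ofNat,
        Nat.cast_ofNat] using this
    have := mul_le_mul_of_nonneg_right hCC hp₂.le
    linarith
  · nlinarith [sq_nonneg l₂]

end CubicForm

/-! ### Ramified primes, the different and the discriminant -/

section Ramification

open Module Polynomial

/-- The discriminant of the cubic polynomial `a x³ - b x² + c x - d`. -/
def cubicDiscr {R : Type*} [CommRing R] (a b c d : R) : R :=
  b ^ 2 * c ^ 2 - 4 * a * c ^ 3 - 4 * b ^ 3 * d - 27 * a ^ 2 * d ^ 2 + 18 * a * b * c * d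

theorem comap_eq_of_sq_dvd_map {k K : Type*} [Field k] [Field K] [Algebra k K]
    {p : Ideal (𝓞 k)} [hp : p.IsMaximal]
    {P : Ideal (𝓞 K)} [P.IsPrime] (hP : P ^ 2 ∣ p.map (algebraMap (𝓞 k) (𝓞 K))) :
    P.comap (algebraMap (𝓞 k) (𝓞 K)) = p := by
  have h1 : p.map (algebraMap (𝓞 k) (𝓞 K)) ≤ P :=
    (Ideal.le_of_dvd hP).trans (Ideal.pow_le_self two_ne_zero)
  exact (hp.eq_of_le (Ideal.IsPrime.ne_top inferInstance) (Ideal.map_le_iff_le_comap.1 h1)).symm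

variable {k K : Type*} [Field k] [NumberField k] [Field K] [NumberField K] [Algebra k K]

/-- At a ramified prime, the discriminant of the minimal polynomial of an integral generator
vanishes. -/
theorem mem_or_cubicDiscr_mem_of_sq_dvd_map (h3 : finrank k K = 3) {a b c d : 𝓞 k} {A : 𝓞 K}
    (hA : ∀ x : k, (A : K) ≠ algebraMap k K x)
    (hrel : (A : K) ^ 3 - algebraMap k K b * (A : K) ^ 2 + algebraMap k K (a * c) * (A : K) -
        algebraMap k K (a ^ 2 * d) = 0)
    {p : Ideal (𝓞 k)} [hp : p.IsMaximal] (hp0 : p ≠ ⊥) {P : Ideal (𝓞 K)} [P.IsPrime]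
    (hP : P ^ 2 ∣ p.map (algebraMap (𝓞 k) (𝓞 K))) : a ∈ p ∨ cubicDiscr a b c d ∈ p := by
  have : FiniteDimensional k K := Module.finite_of_finrank_pos (by omega)
  let φ := algebraMap (𝓞 k) (𝓞 K)
  have hφ : ∀ x : 𝓞 k, ((φ x : 𝓞 K) : K) = algebraMap k K x := fun x => rfl
  have hrel' : A ^ 3 - φ b * A ^ 2 + φ (a * c) * A - φ (a ^ 2 * d) = 0 := by
    apply RingOfIntegers.coe_injective (K := K)
    have : ∀ x : 𝓞 k, algebraMap (𝓞 K) K (φ x) = algebraMap k K (algebraMap (𝓞 k) k x) := hφ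
    simpa [RingOfIntegers.coe_eq_algebraMap, this] using hrel
  let f : (𝓞 k)[X] := C 1 * X ^ 3 + C (-b) * X ^ 2 + C (a * c) * X + C (-(a ^ 2 * d))
  have hmonic : f.Monic := leadingCoeff_cubic one_ne_zero
  have hnat : f.natDegree = 3 := natDegree_cubic one_ne_zero
  have hfA : aeval A f = 0 := by
    rw [← hrel']
    simp only [f, map_add, map_mul, map_pow, aeval_C, aeval_X, map_one, map_neg, φ]
    ring
  have hint : IsIntegral (𝓞 k) A := ⟨f, hmonic, hfA⟩
  have hmin : f = minpoly (𝓞 k) A := by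
    refine eq_of_monic_of_dvd_of_natDegree_le (minpoly.monic hint) hmonic
      (minpoly.isIntegrallyClosed_dvd hint hfA) ?_
    have h1 := congrArg natDegree (minpoly.isIntegrallyClosed_eq_field_fractions k K hint)
    rw [(minpoly.monic hint).natDegree_map] at h1
    rw [hnat, ← h1]
    exact (natDegree_minpoly_eq_three h3 hA).ge
  have hadj : Algebra.adjoin k {algebraMap (𝓞 K) K A} = ⊤ := by
    refine Algebra.adjoin_eq_top_of_primitive_element (Algebra.IsAlgebraic.isAlgebraic _) ?_
    rw [Field.primitive_element_iff_minpoly_natDegree_eq, h3]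
    exact natDegree_minpoly_eq_three h3 hA
  -- The different contains f'(A), and it is divisible by P because P² divides p; so f'(A) ∈ P.
  have h1 := aeval_derivative_mem_differentIdeal (𝓞 k) k K A hadj
  have h2 : P ∣ differentIdeal (𝓞 k) (𝓞 K) := by
    simpa using pow_sub_one_dvd_differentIdeal_aux (𝓞 k) k K P two_ne_zero hp0 hP
  have h4 := Ideal.le_of_dvd h2 h1
  rw [← hmin] at h4
  have h5 : 3 * A ^ 2 - 2 * φ b * A + φ (a * c) ∈ P := by
    have hder : ∀ s t u : 𝓞 k, aeval A (derivative
        (C 1 * X ^ 3 + C s * X ^ 2 + C t * X + C u : (𝓞 k)[X])) =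
        3 * A ^ 2 + 2 * φ s * A + φ t := by
      intro s t u
      simp [φ, map_ofNat]
      ring
    rw [hder, map_neg] at h4
    convert h4 using 1
    ring
  -- The discriminant of f is f'(A)² times the discriminant of the quadratic cofactor f/(x - A),
  -- which is the last factor below.
  have h6 : φ (a ^ 2 * cubicDiscr a b c d) ∈ P := by
    have : φ (a ^ 2 * cubicDiscr a b c d) = (3 * A ^ 2 - 2 * φ b * A + φ (a * c)) *
        ((3 * A ^ 2 - 2 * φ b * A + φ (a * c)) *
          (φ b ^ 2 - 4 * φ (a * c) + 2 * φ b * A - 3 * A ^ 2)) := by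
      simp only [cubicDiscr, map_add, map_sub, map_mul, map_pow, map_ofNat] at hrel' ⊢
      linear_combination (27 * A ^ 3 - 27 * A ^ 2 * φ b + 27 * A * (φ a * φ c) + 4 * φ b ^ 3
        - 18 * φ b * (φ a * φ c) + 27 * (φ a ^ 2 * φ d)) * hrel'
    rw [this]
    exact P.mul_mem_right _ h5
  have h7 : a ^ 2 * cubicDiscr a b c d ∈ p := by
    rw [← comap_eq_of_sq_dvd_map hP]; exact h6
  rcases hp.isPrime.mem_or_mem h7 with h | h
  · exact Or.inl (hp.isPrime.mem_of_pow_mem 2 h)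
  · exact Or.inr h

theorem absNorm_le_absNorm_of_comap_eq {p : Ideal (𝓞 k)} {P : Ideal (𝓞 K)} (hP0 : P ≠ ⊥)
    (hP : P.comap (algebraMap (𝓞 k) (𝓞 K)) = p) : Ideal.absNorm p ≤ Ideal.absNorm P := by
  have : Finite (𝓞 K ⧸ P) := Ideal.finiteQuotientOfFreeOfNeBot P hP0
  change Nat.card (𝓞 k ⧸ p) ≤ Nat.card (𝓞 K ⧸ P)
  exact Nat.card_le_card_of_injective
    (Ideal.quotientMap P (algebraMap (𝓞 k) (𝓞 K)) hP.ge)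
    (Ideal.quotientMap_injective' hP.le)

/-- Each P divides the different of K/ℚ, whose norm is |disc K|; the chosen P lie over different
primes of k, so they are coprime and their product divides it too. This supplies N(q) ≤ X. -/
theorem prod_absNorm_le_abs_discr (Q : Finset (Ideal (𝓞 k)))
    (hQ : ∀ p ∈ Q, p.IsPrime ∧ p ≠ ⊥ ∧
      ∃ P : Ideal (𝓞 K), P.IsPrime ∧ P ^ 2 ∣ p.map (algebraMap (𝓞 k) (𝓞 K))) :
    ((∏ p ∈ Q, Ideal.absNorm p : ℕ) : ℝ) ≤ |(discr K : ℝ)| := by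
  classical
  choose! P hP using fun p hp => (hQ p hp).2.2
  have hmax : ∀ p ∈ Q, p.IsMaximal := fun p hp => (hQ p hp).1.isMaximal (hQ p hp).2.1
  have hcomap : ∀ p ∈ Q, (P p).comap (algebraMap (𝓞 k) (𝓞 K)) = p := fun p hp => by
    have := hmax p hp
    have := (hP p hp).1
    exact comap_eq_of_sq_dvd_map (hP p hp).2
  have hP0 : ∀ p ∈ Q, P p ≠ ⊥ := by
    intro p hp h
    refine (hQ p hp).2.1 ?_
    rw [← hcomap p hp, h]
    exact Ideal.comap_bot_of_injective _ (FaithfulSMul.algebraMap_injective _ _)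
  have hdvd : ∀ p ∈ Q, P p ∣ differentIdeal ℤ (𝓞 K) := by
    intro p hp
    have := hmax p hp
    have h0 : p.under ℤ ≠ ⊥ := Ideal.under_ne_bot ℤ (hQ p hp).2.1
    have hm : (p.under ℤ).IsMaximal := Ideal.IsMaximal.under ℤ p
    have h1 : P p ^ 2 ∣ (p.under ℤ).map (algebraMap ℤ (𝓞 K)) := by
      refine (hP p hp).2.trans ?_
      rw [IsScalarTower.algebraMap_eq ℤ (𝓞 k) (𝓞 K), ← Ideal.map_map]
      exact Ideal.dvd_iff_le.2 (Ideal.map_mono Ideal.map_comap_le)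
    simpa using pow_sub_one_dvd_differentIdeal_aux ℤ ℚ K (P p) two_ne_zero h0 h1
  have hprod : ∏ p ∈ Q, P p ∣ differentIdeal ℤ (𝓞 K) := by
    refine Finset.prod_dvd_of_coprime ?_ hdvd
    intro p hp p' hp' hne
    have h1 : (P p).IsMaximal := (hP p hp).1.isMaximal (hP0 p hp)
    have h2 : (P p').IsMaximal := (hP p' hp').1.isMaximal (hP0 p' hp')
    refine (Ideal.isCoprime_iff_sup_eq).2 (h1.coprime_of_ne h2 fun h => hne ?_)
    rw [← hcomap p hp, ← hcomap p' hp', h]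
  have h1 : ∏ p ∈ Q, Ideal.absNorm (P p) ∣ (discr K).natAbs := by
    rw [← absNorm_differentIdeal K (𝓞 K), ← map_prod]
    exact map_dvd Ideal.absNorm hprod
  have h2 : ∏ p ∈ Q, Ideal.absNorm p ≤ (discr K).natAbs :=
    (Finset.prod_le_prod' fun p hp => absNorm_le_absNorm_of_comap_eq (hP0 p hp)
      (hcomap p hp)).trans (Nat.le_of_dvd (Int.natAbs_pos.2 (discr_ne_zero K)) h1)
  rw [← Int.cast_abs, ← Int.natCast_natAbs, Int.cast_natCast]
  exact_mod_cast h2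

end Ramification

/-! ### Counting cubic polynomials under congruence conditions -/

section Counting

open Module Polynomial

theorem one_add_pow_le (n : ℕ) {x : ℝ} (hx : 0 ≤ x) : (1 + x) ^ n ≤ 2 ^ n * (1 + x ^ n) := by
  rcases le_total x 1 with h | h
  · calc (1 + x) ^ n ≤ 2 ^ n := by gcongr; linarith
      _ ≤ _ := le_mul_of_one_le_right (by positivity) (by linarith [pow_nonneg hx n])
  · calc (1 + x) ^ n ≤ (2 * x) ^ n := by gcongr; linarith
      _ = 2 ^ n * x ^ n := mul_pow _ _ _
      _ ≤ _ := by gcongr; linarith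

theorem prod_ne_bot {k : Type*} [Field k] {Q : Finset (Ideal (𝓞 k))} (hQ : ∀ p ∈ Q, p.IsPrime ∧ p ≠ ⊥) :
    ∏ p ∈ Q, p ≠ ⊥ :=
  Finset.prod_ne_zero_iff.2 fun p hp => (hQ p hp).2

variable {k : Type*} [Field k] [NumberField k]

/-- A residue class modulo `I` contains at most `O(1 + H^n / N(I))` integers of house at most
`H`. -/
theorem card_le_of_sub_mem_ideal {I : Ideal (𝓞 k)} (hI : I ≠ ⊥) (S : Finset (𝓞 k)) {H : ℝ}
    (hH : 0 ≤ H) (hS : ∀ x ∈ S, house (x : k) ≤ H) (hI' : ∀ x ∈ S, ∀ y ∈ S, x - y ∈ I) :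
    (S.card : ℝ) ≤ 4 ^ finrank ℚ k * (1 + H ^ finrank ℚ k / Ideal.absNorm I) := by
  classical
  have hn : finrank ℚ k ≠ 0 := finrank_pos.ne'
  have hN : 0 < (Ideal.absNorm I : ℝ) := by
    exact_mod_cast Nat.pos_of_ne_zero (Ideal.absNorm_eq_zero_iff.not.2 hI)
  -- A nonzero element of I has house at least N(I)^(1/n): this is the separation for the packing.
  set δ : ℝ := (Ideal.absNorm I : ℝ) ^ ((finrank ℚ k : ℝ)⁻¹) with hδ
  have hδ0 : 0 < δ := Real.rpow_pos_of_pos hN _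
  have hδn : δ ^ finrank ℚ k = Ideal.absNorm I := Real.rpow_inv_natCast_pow hN.le hn
  have hinj : Function.Injective (fun x : 𝓞 k => (x : k)) := RingOfIntegers.coe_injective
  have h1 := card_le_of_separated_of_house_le (k := k) (1 : k) (S.image fun x : 𝓞 k => (x : k))
    hH hδ0 (fun x _ => ⟨x, by simp⟩)
    (by
      intro z hz
      obtain ⟨x, hx, rfl⟩ := Finset.mem_image.1 hz
      exact hS x hx)
    (by
      intro z hz w hw hzw
      obtain ⟨x, hx, rfl⟩ := Finset.mem_image.1 hz
      obtain ⟨y, hy, rfl⟩ := Finset.mem_image.1 hw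
      have h2 := absNorm_le_house_pow I (hI' x hx y hy) (sub_ne_zero.2 fun h => hzw (by rw [h]))
      rw [← hδn] at h2
      have h3 := (pow_le_pow_iff_left₀ hδ0.le (house_nonneg _) hn).1 h2
      simpa using h3)
  rw [Finset.card_image_of_injective _ hinj] at h1
  calc (S.card : ℝ) ≤ _ := h1
    _ ≤ 2 ^ finrank ℚ k * (1 + (2 * H / δ) ^ finrank ℚ k) := one_add_pow_le _ (by positivity)
    _ = 2 ^ finrank ℚ k * 1 + (2 * 2) ^ finrank ℚ k * (H ^ finrank ℚ k / Ideal.absNorm I) := by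
        rw [div_pow, mul_pow, hδn, mul_pow]; ring
    _ ≤ 4 ^ finrank ℚ k * 1 + 4 ^ finrank ℚ k * (H ^ finrank ℚ k / Ideal.absNorm I) := by
        gcongr <;> norm_num
    _ = _ := by ring

theorem card_le_of_house_le (S : Finset (𝓞 k)) {H : ℝ} (hH : 1 ≤ H)
    (hS : ∀ x ∈ S, house (x : k) ≤ H) :
    (S.card : ℝ) ≤ 2 * 4 ^ finrank ℚ k * H ^ finrank ℚ k := by
  have h := card_le_of_sub_mem_ideal (I := ⊤) top_ne_bot S (by linarith) hS (by simp)
  rw [Ideal.absNorm_top, Nat.cast_one, div_one] at h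
  have h1 : 1 ≤ H ^ finrank ℚ k := one_le_pow₀ hH
  calc _ ≤ _ := h
    _ ≤ 4 ^ finrank ℚ k * (H ^ finrank ℚ k + H ^ finrank ℚ k) := by gcongr
    _ = _ := by ring

theorem mem_prod_of_forall_mem {Q : Finset (Ideal (𝓞 k))} (hQ : ∀ p ∈ Q, p.IsPrime ∧ p ≠ ⊥)
    {x : 𝓞 k} (hx : ∀ p ∈ Q, x ∈ p) : x ∈ ∏ p ∈ Q, p := by
  rw [← Ideal.span_singleton_le_iff_mem, ← Ideal.dvd_iff_le]
  refine Finset.prod_dvd_of_coprime (s := fun p : Ideal (𝓞 k) => p) ?_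
    fun p hp => Ideal.dvd_iff_le.2 ((Ideal.span_singleton_le_iff_mem p).2 (hx p hp))
  intro p hp p' hp' hne
  have h1 := (hQ p hp).1.isMaximal (hQ p hp).2
  have h2 := (hQ p' hp').1.isMaximal (hQ p' hp').2
  exact Ideal.isCoprime_iff_sup_eq.2 (h1.coprime_of_ne h2 hne)

theorem card_roots_quadratic_le_two {F : Type*} [Field F] (S : Finset F) {r s t : F} (hr : r ≠ 0)
    (hS : ∀ x ∈ S, r * x ^ 2 + s * x + t = 0) : S.card ≤ 2 := by
  classical
  set f : F[X] := C r * X ^ 2 + C s * X + C t with hf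
  have hdeg : f.natDegree = 2 := natDegree_quadratic hr
  have hf0 : f ≠ 0 := fun h => by rw [h] at hdeg; simp at hdeg
  have hsub : S ⊆ f.roots.toFinset := by
    intro x hx
    rw [Multiset.mem_toFinset, mem_roots hf0]
    simpa [hf, IsRoot] using hS x hx
  calc S.card ≤ f.roots.toFinset.card := Finset.card_le_card hsub
    _ ≤ f.roots.card := Multiset.toFinset_card_le _
    _ ≤ 2 := hdeg ▸ card_roots' f

/-- For fixed `a, b, c`, the number of `d` such that the discriminant vanishes modulo given
primes. -/
theorem card_le_of_cubicDiscr_mem (Q : Finset (Ideal (𝓞 k))) (hQ : ∀ p ∈ Q, p.IsPrime ∧ p ≠ ⊥)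
    (h3 : ∀ p ∈ Q, (3 : 𝓞 k) ∉ p) {a b c : 𝓞 k} (ha : ∀ p ∈ Q, a ∉ p) (S : Finset (𝓞 k)) {H : ℝ}
    (hH : 0 ≤ H) (hS : ∀ d ∈ S, house (d : k) ≤ H)
    (hd : ∀ d ∈ S, ∀ p ∈ Q, cubicDiscr a b c d ∈ p) :
    (S.card : ℝ) ≤ 2 ^ Q.card *
      (4 ^ finrank ℚ k * (1 + H ^ finrank ℚ k / ∏ p ∈ Q, (Ideal.absNorm p : ℝ))) := by
  classical
  -- The residue vector of d takes at most two values at each prime, and each of its fibres lies in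
  -- one class modulo the product of the primes.
  let g : 𝓞 k → ∀ p ∈ Q, 𝓞 k ⧸ p := fun d p _ => Ideal.Quotient.mk p d
  have himage : (S.image g).card ≤ 2 ^ Q.card := by
    have hsub : S.image g ⊆ Q.pi fun p => S.image (Ideal.Quotient.mk p) := by
      intro f hf
      obtain ⟨d, hd, rfl⟩ := Finset.mem_image.1 hf
      exact Finset.mem_pi.2 fun p _ => Finset.mem_image_of_mem _ hd
    refine (Finset.card_le_card hsub).trans ?_
    rw [Finset.card_pi]
    refine Finset.prod_le_pow_card _ _ _ fun p hp => ?_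
    have hmax := (hQ p hp).1.isMaximal (hQ p hp).2
    let _ : Field (𝓞 k ⧸ p) := Ideal.Quotient.field p
    let m := Ideal.Quotient.mk p
    refine card_roots_quadratic_le_two (r := m (-(27 * a ^ 2)))
      (s := m (18 * a * b * c - 4 * b ^ 3)) (t := m (b ^ 2 * c ^ 2 - 4 * a * c ^ 3)) _ ?_ ?_
    · rw [Ne, Ideal.Quotient.eq_zero_iff_mem, neg_mem_iff]
      intro h
      rcases hmax.isPrime.mem_or_mem h with h | h
      · refine h3 p hp (hmax.isPrime.mem_of_pow_mem 3 ?_)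
        norm_num
        exact h
      · exact ha p hp (hmax.isPrime.mem_of_pow_mem 2 h)
    · intro x hx
      obtain ⟨d, hdS, rfl⟩ := Finset.mem_image.1 hx
      have := Ideal.Quotient.eq_zero_iff_mem.2 (hd d hdS p hp)
      rw [← this]
      simp only [m, ← map_pow, ← map_mul, ← map_add]
      congr 1
      simp only [cubicDiscr]
      ring
  have hfib : ∀ f ∈ S.image g, ((S.filter fun d => g d = f).card : ℝ) ≤
      4 ^ finrank ℚ k * (1 + H ^ finrank ℚ k / ∏ p ∈ Q, (Ideal.absNorm p : ℝ)) := by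
    intro f _
    have := card_le_of_sub_mem_ideal (prod_ne_bot hQ) (S.filter fun d => g d = f) hH
      (fun x hx => hS x (Finset.mem_filter.1 hx).1)
      (by
        intro x hx y hy
        refine mem_prod_of_forall_mem hQ fun p hp => ?_
        rw [← Ideal.Quotient.eq]
        have hxy := (Finset.mem_filter.1 hx).2.trans (Finset.mem_filter.1 hy).2.symm
        exact congrFun (congrFun hxy p) hp)
    rw [map_prod, Nat.cast_prod] at this
    exact this
  rw [Finset.card_eq_sum_card_image g S, Nat.cast_sum]
  calc _ ≤ ∑ _ ∈ S.image g, _ := Finset.sum_le_sum hfib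
    _ = (S.image g).card * _ := by rw [Finset.sum_const, nsmul_eq_mul]
    _ ≤ _ := by
      gcongr
      exact_mod_cast himage

/-- The number of cubic polynomials with coefficients in a box whose discriminant vanishes modulo
given primes. -/
theorem card_cubic_le (Q : Finset (Ideal (𝓞 k))) (hQ : ∀ p ∈ Q, p.IsPrime ∧ p ≠ ⊥)
    (h3 : ∀ p ∈ Q, (3 : 𝓞 k) ∉ p) (T : Finset (𝓞 k × 𝓞 k × 𝓞 k × 𝓞 k)) {H₁ H₂ H₃ H₄ : ℝ}
    (hH₁ : 0 ≤ H₁) (hH₂ : 1 ≤ H₂) (hH₃ : 1 ≤ H₃) (hH₄ : 0 ≤ H₄)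
    (hT : ∀ t ∈ T, t.1 ≠ 0 ∧ house (t.1 : k) ≤ H₁ ∧ house (t.2.1 : k) ≤ H₂ ∧
      house (t.2.2.1 : k) ≤ H₃ ∧ house (t.2.2.2 : k) ≤ H₄)
    (hd : ∀ t ∈ T, ∀ p ∈ Q, t.1 ∈ p ∨ cubicDiscr t.1 t.2.1 t.2.2.1 t.2.2.2 ∈ p) :
    (T.card : ℝ) ≤ 8 * 256 ^ finrank ℚ k * 4 ^ Q.card * (H₁ * H₂ * H₃) ^ finrank ℚ k *
      (1 + H₄ ^ finrank ℚ k / ∏ p ∈ Q, (Ideal.absNorm p : ℝ)) := by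
  classical
  set n := finrank ℚ k with hn
  let SA := T.image fun t => t.1
  let SB := T.image fun t => t.2.1
  let SC := T.image fun t => t.2.2.1
  let N : Finset (Ideal (𝓞 k)) → ℝ := fun R => ∏ p ∈ R, (Ideal.absNorm p : ℝ)
  have hN1 : ∀ R ⊆ Q, 1 ≤ N R := by
    intro R hR
    have h : ∏ p ∈ R, Ideal.absNorm p ≠ 0 := Finset.prod_ne_zero_iff.2 fun p hp =>
      Ideal.absNorm_eq_zero_iff.not.2 (hQ p (hR hp)).2
    simp only [N, ← Nat.cast_prod]
    exact_mod_cast Nat.pos_of_ne_zero h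
  -- Primes containing a impose nothing on d, which costs a factor N(div a). Such a lie in the
  -- product of these primes, and are rarer by the same factor.
  let div : 𝓞 k → Finset (Ideal (𝓞 k)) := fun a => Q.filter fun p => a ∈ p
  let G : 𝓞 k → ℝ := fun a => 1 + H₄ ^ n / N Q * N (div a)
  have hsplit : ∀ a, N Q = N (div a) * N (Q.filter fun p => a ∉ p) := fun a =>
    (Finset.prod_filter_mul_prod_filter_not Q _ _).symm
  have hfib : ∀ s ∈ SA ×ˢ SB ×ˢ SC,
      ((T.filter fun t => (t.1, t.2.1, t.2.2.1) = s).card : ℝ) ≤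
        2 ^ Q.card * 4 ^ n * G s.1 := by
    rintro ⟨a, b, c⟩ -
    let S := (T.filter fun t => (t.1, t.2.1, t.2.2.1) = (a, b, c)).image fun t => t.2.2.2
    have hcard : S.card = (T.filter fun t => (t.1, t.2.1, t.2.2.1) = (a, b, c)).card := by
      refine Finset.card_image_of_injOn ?_
      rintro ⟨a₁, b₁, c₁, d₁⟩ h₁ ⟨a₂, b₂, c₂, d₂⟩ h₂ h
      have e₁ := (Finset.mem_filter.1 h₁).2
      have e₂ := (Finset.mem_filter.1 h₂).2
      simp only [Prod.mk.injEq] at e₁ e₂ h ⊢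
      exact ⟨e₁.1.trans e₂.1.symm, e₁.2.1.trans e₂.2.1.symm, e₁.2.2.trans e₂.2.2.symm, h⟩
    have hmem : ∀ d ∈ S, (a, b, c, d) ∈ T := by
      intro d hd
      obtain ⟨⟨a', b', c', d'⟩, ht, rfl⟩ := Finset.mem_image.1 hd
      obtain ⟨ht', he⟩ := Finset.mem_filter.1 ht
      simp only [Prod.mk.injEq] at he
      rw [← he.1, ← he.2.1, ← he.2.2]
      exact ht'
    rw [← hcard]
    have hsub : (Q.filter fun p => a ∉ p) ⊆ Q := Finset.filter_subset _ _
    have h1 := card_le_of_cubicDiscr_mem (Q.filter fun p => a ∉ p) (fun p hp => hQ p (hsub hp))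
      (fun p hp => h3 p (hsub hp)) (a := a) (b := b) (c := c)
      (fun p hp => (Finset.mem_filter.1 hp).2) S hH₄
      (fun d hd => (hT _ (hmem d hd)).2.2.2.2)
      (fun d hd' p hp => (hd _ (hmem d hd') p (hsub hp)).resolve_left (Finset.mem_filter.1 hp).2)
    refine h1.trans ?_
    have h2 : H₄ ^ n / ∏ p ∈ Q.filter fun p => a ∉ p, (Ideal.absNorm p : ℝ) =
        H₄ ^ n / N Q * N (div a) := by
      have := hN1 (div a) (Finset.filter_subset _ _)
      have := hN1 _ hsub
      rw [hsplit a]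
      simp only [N] at *
      field_simp
    rw [h2, mul_assoc]
    have h4 : (2 : ℝ) ^ (Q.filter fun p => a ∉ p).card ≤ 2 ^ Q.card :=
      pow_le_pow_right₀ one_le_two (Finset.card_le_card hsub)
    have hG : 0 ≤ G a := by
      have := hN1 Q subset_rfl
      have := hN1 (div a) (Finset.filter_subset _ _)
      simp only [G]
      positivity
    exact mul_le_mul_of_nonneg_right h4 (by positivity)
  have hA : ∀ R ∈ Q.powerset, ((SA.filter fun a => div a = R).card : ℝ) ≤
      2 * 4 ^ n * (H₁ ^ n / N R) := by
    intro R hR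
    rw [Finset.mem_powerset] at hR
    have hQR : ∀ p ∈ R, p.IsPrime ∧ p ≠ ⊥ := fun p hp => hQ p (hR hp)
    have hmemR : ∀ a ∈ SA.filter fun a => div a = R, a ∈ ∏ p ∈ R, p := by
      intro a ha
      refine mem_prod_of_forall_mem hQR fun p hp => ?_
      rw [← (Finset.mem_filter.1 ha).2] at hp
      exact (Finset.mem_filter.1 hp).2
    have hbd : ∀ a ∈ SA.filter fun a => div a = R, a ≠ 0 ∧ house (a : k) ≤ H₁ := by
      intro a ha
      obtain ⟨t, ht, rfl⟩ := Finset.mem_image.1 (Finset.mem_filter.1 ha).1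
      exact ⟨(hT t ht).1, (hT t ht).2.1⟩
    have hNR := hN1 R hR
    rcases Finset.eq_empty_or_nonempty (SA.filter fun a => div a = R) with h0 | ⟨a₀, ha₀⟩
    · rw [h0, Finset.card_empty, Nat.cast_zero]
      positivity
    · have h1 := card_le_of_sub_mem_ideal (prod_ne_bot hQR) (SA.filter fun a => div a = R) hH₁
        (fun a ha => (hbd a ha).2) (fun x hx y hy => sub_mem (hmemR x hx) (hmemR y hy))
      -- Since a₀ ≠ 0, this gives N(R) ≤ H₁^n, so the 1 in the packing bound is absorbed into H₁^n /
      -- N(R).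
      have h2 := absNorm_le_house_pow _ (hmemR a₀ ha₀) (hbd a₀ ha₀).1
      rw [map_prod, Nat.cast_prod] at h1 h2
      have h4 : N R ≤ H₁ ^ n :=
        h2.trans (pow_le_pow_left₀ (house_nonneg _) (hbd a₀ ha₀).2 _)
      have h5 : 1 ≤ H₁ ^ n / N R := (one_le_div (by linarith)).2 h4
      calc _ ≤ _ := h1
        _ ≤ 4 ^ n * (H₁ ^ n / N R + H₁ ^ n / N R) := by gcongr
        _ = _ := by ring
  -- The sum over the 2^|Q| possible sets `div a`, together with the 2^|Q| choices of residues of d,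
  -- makes up 4^|Q|.
  have hsumA : ∑ a ∈ SA, G a ≤ 2 ^ Q.card * (2 * 4 ^ n * H₁ ^ n * (1 + H₄ ^ n / N Q)) := by
    rw [← Finset.sum_fiberwise_of_maps_to (t := Q.powerset) (g := div)
      fun a _ => Finset.mem_powerset.2 (Finset.filter_subset _ _)]
    calc _ ≤ ∑ R ∈ Q.powerset, 2 * 4 ^ n * H₁ ^ n * (1 + H₄ ^ n / N Q) := by
          refine Finset.sum_le_sum fun R hR => ?_
          have hNR := hN1 R (Finset.mem_powerset.1 hR)
          have hNQ := hN1 Q subset_rfl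
          have hG : ∀ a ∈ SA.filter fun a => div a = R, G a = 1 + H₄ ^ n / N Q * N R := by
            intro a ha
            simp only [G, (Finset.mem_filter.1 ha).2]
          rw [Finset.sum_congr rfl hG, Finset.sum_const, nsmul_eq_mul]
          calc _ ≤ 2 * 4 ^ n * (H₁ ^ n / N R) * (1 + H₄ ^ n / N Q * N R) :=
                mul_le_mul_of_nonneg_right (hA R hR) (by positivity)
            _ = 2 * 4 ^ n * (H₁ ^ n * (1 / N R) + H₁ ^ n * (H₄ ^ n / N Q)) := by
                field_simp
            _ ≤ 2 * 4 ^ n * (H₁ ^ n * 1 + H₁ ^ n * (H₄ ^ n / N Q)) := by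
                gcongr
                exact (div_le_one (by linarith)).2 hNR
            _ = _ := by ring
      _ = _ := by
          rw [Finset.sum_const, nsmul_eq_mul, Finset.card_powerset]
          push_cast
          rfl
  have hB : (SB.card : ℝ) ≤ 2 * 4 ^ n * H₂ ^ n := card_le_of_house_le SB hH₂ (by
    intro x hx
    obtain ⟨t, ht, rfl⟩ := Finset.mem_image.1 hx
    exact (hT t ht).2.2.1)
  have hC : (SC.card : ℝ) ≤ 2 * 4 ^ n * H₃ ^ n := card_le_of_house_le SC hH₃ (by
    intro x hx
    obtain ⟨t, ht, rfl⟩ := Finset.mem_image.1 hx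
    exact (hT t ht).2.2.2.1)
  have hNQ := hN1 Q subset_rfl
  rw [Finset.card_eq_sum_card_fiberwise (f := fun t => (t.1, t.2.1, t.2.2.1))
    (t := SA ×ˢ SB ×ˢ SC) (by
      intro t ht
      simp only [Finset.coe_product, Set.mem_prod]
      exact ⟨Finset.mem_image_of_mem _ ht, Finset.mem_image_of_mem _ ht,
        Finset.mem_image_of_mem _ ht⟩), Nat.cast_sum]
  calc _ ≤ ∑ s ∈ SA ×ˢ SB ×ˢ SC, 2 ^ Q.card * 4 ^ n * G s.1 := Finset.sum_le_sum hfib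
    _ = 2 ^ Q.card * 4 ^ n * ((∑ a ∈ SA, G a) * (SB.card * SC.card)) := by
        rw [← Finset.mul_sum, Finset.sum_product]
        congr 1
        simp only [Finset.sum_const, Finset.card_product, nsmul_eq_mul, ← Finset.mul_sum]
        push_cast
        ring
    _ ≤ 2 ^ Q.card * 4 ^ n * ((2 ^ Q.card * (2 * 4 ^ n * H₁ ^ n * (1 + H₄ ^ n / N Q))) *
          ((2 * 4 ^ n * H₂ ^ n) * (2 * 4 ^ n * H₃ ^ n))) := by
        gcongr
    _ = _ := by
        rw [show (256 : ℝ) = 4 * 4 * 4 * 4 by norm_num, show (4 : ℝ) ^ Q.card = (2 * 2) ^ Q.card by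
          norm_num]
        simp only [mul_pow, N]
        ring

end Counting

/-! ### Many translated cubics for each field -/

section CubicFamily

open Module Polynomial

/-- `ρ` is a root of `a x³ - b x² + c x - d` outside of the base field. -/
def IsCubicGenerator {k K : Type*} [Field k] [Field K] [Algebra k K]
    (t : 𝓞 k × 𝓞 k × 𝓞 k × 𝓞 k) (ρ : K) : Prop :=
  (∀ x : k, ρ ≠ algebraMap k K x) ∧
    algebraMap k K t.1 * ρ ^ 3 - algebraMap k K t.2.1 * ρ ^ 2 + algebraMap k K t.2.2.1 * ρ -
      algebraMap k K t.2.2.2 = 0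

theorem IsCubicGenerator.minpoly_eq {k K : Type*} [Field k] [Field K] [Algebra k K]
    (h3 : finrank k K = 3) {t : 𝓞 k × 𝓞 k × 𝓞 k × 𝓞 k} (ht : t.1 ≠ 0) {ρ : K}
    (h : IsCubicGenerator t ρ) :
    minpoly k ρ = C (t.1 : k)⁻¹ * (C (t.1 : k) * X ^ 3 + C (-(t.2.1 : k)) * X ^ 2 +
      C (t.2.2.1 : k) * X + C (-(t.2.2.2 : k))) := by
  have : FiniteDimensional k K := Module.finite_of_finrank_pos (by omega)
  have ha : (t.1 : k) ≠ 0 := by simpa using ht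
  set f : k[X] := C (t.1 : k) * X ^ 3 + C (-(t.2.1 : k)) * X ^ 2 +
      C (t.2.2.1 : k) * X + C (-(t.2.2.2 : k)) with hf
  have hdeg : f.natDegree = 3 := natDegree_cubic ha
  have hlead : f.leadingCoeff = t.1 := leadingCoeff_cubic ha
  have hmonic : (C (t.1 : k)⁻¹ * f).Monic := by
    rw [Monic, leadingCoeff_mul, leadingCoeff_C, hlead, inv_mul_cancel₀ ha]
  refine (eq_of_monic_of_dvd_of_natDegree_le (minpoly.monic
    (Algebra.IsIntegral.isIntegral ρ)) hmonic (minpoly.dvd k ρ ?_) ?_).symm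
  · have h0 : aeval ρ f = 0 := by
      rw [← h.2]
      simp only [hf, map_add, map_mul, map_pow, aeval_C, aeval_X, map_neg]
      ring
    rw [map_mul, h0, mul_zero]
  · rw [natDegree_minpoly_eq_three h3 h.1, natDegree_C_mul (inv_ne_zero ha), hdeg]

/-- Both roots are primitive with the same minimal polynomial. Consequently non-isomorphic fields
own disjoint sets of tuples. -/
theorem IsCubicGenerator.nonempty_algEquiv {k K L : Type*} [Field k] [Field K] [Algebra k K]
    [Field L] [Algebra k L] (hK : finrank k K = 3) (hL : finrank k L = 3)
    {t : 𝓞 k × 𝓞 k × 𝓞 k × 𝓞 k} (ht : t.1 ≠ 0) {ρ : K} {ρ' : L}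
    (h : IsCubicGenerator t ρ) (h' : IsCubicGenerator t ρ') : Nonempty (K ≃ₐ[k] L) := by
  have : FiniteDimensional k K := Module.finite_of_finrank_pos (by omega)
  have : FiniteDimensional k L := Module.finite_of_finrank_pos (by omega)
  have e := h.minpoly_eq hK ht
  rw [← h'.minpoly_eq hL ht] at e
  have t₁ : IntermediateField.adjoin k {ρ} = ⊤ :=
    (Field.primitive_element_iff_minpoly_natDegree_eq k ρ).2
      ((natDegree_minpoly_eq_three hK h.1).trans hK.symm)
  have t₂ : IntermediateField.adjoin k {ρ'} = ⊤ :=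
    (Field.primitive_element_iff_minpoly_natDegree_eq k ρ').2
      ((natDegree_minpoly_eq_three hL h'.1).trans hL.symm)
  have iρ : IsIntegral k ρ := Algebra.IsIntegral.isIntegral ρ
  have iρ' : IsIntegral k ρ' := Algebra.IsIntegral.isIntegral ρ'
  have e' : minpoly k (IntermediateField.adjoin.powerBasis iρ).gen =
      minpoly k (IntermediateField.adjoin.powerBasis iρ').gen := by
    rw [IntermediateField.adjoin.powerBasis_gen, IntermediateField.adjoin.powerBasis_gen,
      IntermediateField.minpoly_gen, IntermediateField.minpoly_gen, e]
  exact ⟨((IntermediateField.topEquiv.symm.trans (IntermediateField.equivOfEq t₁.symm)).trans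
    (PowerBasis.equivOfMinpoly _ _ e')).trans
      ((IntermediateField.equivOfEq t₂).trans IntermediateField.topEquiv)⟩

/-- The coefficients of `g(x - m)` for `g = a x³ - b x² + c x - d`. -/
def cubicTranslate {R : Type*} [CommRing R] (t : R × R × R × R) (m : R) : R × R × R × R :=
  (t.1, t.2.1 + 3 * t.1 * m, t.2.2.1 + 2 * t.2.1 * m + 3 * t.1 * m ^ 2,
    t.2.2.2 + t.2.2.1 * m + t.2.1 * m ^ 2 + t.1 * m ^ 3)

theorem cubicDiscr_cubicTranslate {R : Type*} [CommRing R] (t : R × R × R × R) (m : R) :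
    cubicDiscr (cubicTranslate t m).1 (cubicTranslate t m).2.1 (cubicTranslate t m).2.2.1
      (cubicTranslate t m).2.2.2 = cubicDiscr t.1 t.2.1 t.2.2.1 t.2.2.2 := by
  simp only [cubicTranslate, cubicDiscr]
  ring

theorem cubicTranslate_injective {R : Type*} [CommRing R] [IsDomain R] [CharZero R]
    {t : R × R × R × R} (ht : t.1 ≠ 0) : Function.Injective (cubicTranslate t) := by
  intro m m' h
  have h1 : t.2.1 + 3 * t.1 * m = t.2.1 + 3 * t.1 * m' := congrArg (fun s => s.2.1) h
  exact mul_left_cancel₀ (mul_ne_zero (OfNat.ofNat_ne_zero 3) ht) (add_left_cancel h1)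

theorem IsCubicGenerator.translate {k K : Type*} [Field k] [Field K] [Algebra k K]
    {t : 𝓞 k × 𝓞 k × 𝓞 k × 𝓞 k} {ρ : K} (h : IsCubicGenerator t ρ) (m : 𝓞 k) :
    IsCubicGenerator (cubicTranslate t m) (ρ + algebraMap k K m) := by
  refine ⟨fun x hx => h.1 (x - m) (by rw [map_sub, ← hx]; ring), ?_⟩
  have := h.2
  simp only [cubicTranslate, RingOfIntegers.coe_eq_algebraMap, map_add, map_mul, map_pow,
    map_ofNat] at this ⊢
  linear_combination this

/-- With M = l₂/l₁ the bounds on a, b, c, d are C l₁ times M⁻¹, 1, M, M², so each factor m moves one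
coefficient's bound to the next. The constants are 1+3, 1+2+3 and 1+1+1+1. -/
theorem house_cubicTranslate_le {k : Type*} [Field k] [NumberField k]
    {t : 𝓞 k × 𝓞 k × 𝓞 k × 𝓞 k} {m : 𝓞 k} {l₁ l₂ C : ℝ} (hl₁ : 0 < l₁) (hl₂ : 0 < l₂) (hC : 0 ≤ C)
    (ha : house (t.1 : k) * l₂ ≤ C * l₁ ^ 2) (hb : house (t.2.1 : k) ≤ C * l₁)
    (hc : house (t.2.2.1 : k) ≤ C * l₂) (hd : house (t.2.2.2 : k) * l₁ ≤ C * l₂ ^ 2)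
    (hm : house (m : k) ≤ l₂ / l₁) :
    house ((cubicTranslate t m).2.1 : k) ≤ 4 * C * l₁ ∧
    house ((cubicTranslate t m).2.2.1 : k) ≤ 6 * C * l₂ ∧
    house ((cubicTranslate t m).2.2.2 : k) ≤ 4 * C * (l₂ ^ 2 / l₁) := by
  set M := l₂ / l₁ with hM
  have hM0 : 0 < M := by positivity
  have hl : l₂ = M * l₁ := by rw [hM]; field_simp
  obtain ⟨a, b, c, d⟩ := t
  simp only at ha hb hc hd
  have ha' : house (a : k) ≤ C * (l₁ / M) := by
    rw [← mul_div_assoc, le_div_iff₀ hM0]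
    rw [hl] at ha
    nlinarith
  have hd' : house (d : k) ≤ C * (M ^ 2 * l₁) := by
    rw [hl] at hd
    refine le_of_mul_le_mul_right (hd.trans (le_of_eq ?_)) hl₁
    ring
  have h2 : house (2 : k) = 2 := by
    have := house_intCast (K := k) 2
    simpa using this
  have h3 : house (3 : k) = 3 := by
    have := house_intCast (K := k) 3
    simpa using this
  have pm : ∀ (x : 𝓞 k) (e : ℕ) (X : ℝ), 0 ≤ X → house (x : k) ≤ X →
      house ((x : k) * (m : k) ^ e) ≤ X * M ^ e := fun x e X hX hx =>
    (house_mul_le _ _).trans (mul_le_mul hx ((house_pow_le _ _).trans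
      (pow_le_pow_left₀ (house_nonneg _) hm e)) (house_nonneg _) hX)
  have pc : ∀ (r : k) (x : k), house (r * x) ≤ house r * house x := house_mul_le
  have ea1 := pm a 1 _ (by positivity) ha'
  have ea2 := pm a 2 _ (by positivity) ha'
  have ea3 := pm a 3 _ (by positivity) ha'
  have eb1 := pm b 1 _ (by positivity) hb
  have eb2 := pm b 2 _ (by positivity) hb
  have ec1 := pm c 1 _ (by positivity) hc
  refine ⟨?_, ?_, ?_⟩
  · have e : ((cubicTranslate (a, b, c, d) m).2.1 : k) = (b : k) + 3 * ((a : k) * (m : k) ^ 1) := by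
      simp only [cubicTranslate, RingOfIntegers.coe_eq_algebraMap, map_add, map_mul, map_ofNat]
      ring
    rw [e]
    have f1 := house_add_le (b : k) (3 * ((a : k) * (m : k) ^ 1))
    have f2 := pc 3 ((a : k) * (m : k) ^ 1)
    rw [h3] at f2
    have : C * (l₁ / M) * M ^ 1 = C * l₁ := by field_simp
    linarith
  · have e : ((cubicTranslate (a, b, c, d) m).2.2.1 : k) =
        (c : k) + 2 * ((b : k) * (m : k) ^ 1) + 3 * ((a : k) * (m : k) ^ 2) := by
      simp only [cubicTranslate, RingOfIntegers.coe_eq_algebraMap, map_add, map_mul, map_ofNat,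
        map_pow]
      ring
    rw [e]
    have f1 := house_add_le ((c : k) + 2 * ((b : k) * (m : k) ^ 1)) (3 * ((a : k) * (m : k) ^ 2))
    have f2 := house_add_le (c : k) (2 * ((b : k) * (m : k) ^ 1))
    have f3 := pc 3 ((a : k) * (m : k) ^ 2)
    have f4 := pc 2 ((b : k) * (m : k) ^ 1)
    rw [h3] at f3
    rw [h2] at f4
    have g1 : C * (l₁ / M) * M ^ 2 = C * l₂ := by rw [hl]; field_simp
    have g2 : C * l₁ * M ^ 1 = C * l₂ := by rw [hl]; ring
    linarith
  · have e : ((cubicTranslate (a, b, c, d) m).2.2.2 : k) =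
        (d : k) + (c : k) * (m : k) ^ 1 + (b : k) * (m : k) ^ 2 + (a : k) * (m : k) ^ 3 := by
      simp only [cubicTranslate, RingOfIntegers.coe_eq_algebraMap, map_add, map_mul, map_pow]
      ring
    rw [e]
    have f1 := house_add_le ((d : k) + (c : k) * (m : k) ^ 1 + (b : k) * (m : k) ^ 2)
      ((a : k) * (m : k) ^ 3)
    have f2 := house_add_le ((d : k) + (c : k) * (m : k) ^ 1) ((b : k) * (m : k) ^ 2)
    have f3 := house_add_le (d : k) ((c : k) * (m : k) ^ 1)
    have g0 : l₂ ^ 2 / l₁ = M ^ 2 * l₁ := by rw [hl]; field_simp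
    have g1 : C * (l₁ / M) * M ^ 3 = C * (M ^ 2 * l₁) := by field_simp
    have g2 : C * l₁ * M ^ 2 = C * (M ^ 2 * l₁) := by ring
    have g3 : C * l₂ * M ^ 1 = C * (M ^ 2 * l₁) := by rw [hl]; ring
    rw [g0]
    linarith

/-- Every cubic extension of `k` is generated by a root of many cubic polynomials with coefficients
in a box of dyadic shape. -/
theorem exists_cubic_family (k : Type*) [Field k] [NumberField k] : ∃ C : ℝ, 1 ≤ C ∧
    ∀ (K : Type*) [Field K] [NumberField K] [Algebra k K], finrank k K = 3 →
    ∃ i j : ℕ, i ≤ j ∧ ((2 : ℝ) ^ (i + j)) ^ finrank ℚ k ≤ C * √|(discr K : ℝ)| ∧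
    ∃ F : Finset (𝓞 k × 𝓞 k × 𝓞 k × 𝓞 k), ((2 : ℝ) ^ j / 2 ^ i) ^ finrank ℚ k ≤ C * F.card ∧
    ∀ t ∈ F, (t.1 ≠ 0 ∧ house (t.1 : k) ≤ C * (4 ^ i / 2 ^ j) ∧ house (t.2.1 : k) ≤ C * 2 ^ i ∧
      house (t.2.2.1 : k) ≤ C * 2 ^ j ∧ house (t.2.2.2 : k) ≤ C * (4 ^ j / 2 ^ i)) ∧
      (∃ ρ : K, IsCubicGenerator t ρ) ∧
      ∀ p : Ideal (𝓞 k), p.IsPrime → p ≠ ⊥ → ∀ P : Ideal (𝓞 K), P.IsPrime →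
        P ^ 2 ∣ p.map (algebraMap (𝓞 k) (𝓞 K)) →
        t.1 ∈ p ∨ cubicDiscr t.1 t.2.1 t.2.2.1 t.2.2.2 ∈ p := by
  classical
  obtain ⟨C, hC, key⟩ := exists_cubic_form k
  set n := finrank ℚ k with hn
  set S := √|(discr k : ℝ)| with hS
  have hS0 : 0 ≤ S := Real.sqrt_nonneg _
  -- 16C covers the box after l₁ and l₂ are rounded down to powers of 2, and 4^n S the lower bound
  -- on the number of translates.
  set C' := 16 * C + 4 ^ n * S with hC'
  have hS4 : 0 ≤ 4 ^ n * S := by positivity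
  have hCC : 16 * C ≤ C' := by linarith
  have hSC : 4 ^ n * S ≤ C' := by linarith
  clear_value C'
  refine ⟨C', by linarith, ?_⟩
  intro K _ _ _ h3
  obtain ⟨l₁, l₂, h1, h12, hvol, a, b, c, d, A, ha0, hA, hrel, ha, hb, hc, hd⟩ := key K h3
  obtain ⟨i, hi, hi'⟩ := exists_nat_pow_near h1 (one_lt_two (α := ℝ))
  obtain ⟨j, hj, hj'⟩ := exists_nat_pow_near (h1.trans h12) (one_lt_two (α := ℝ))
  have hp₁ : 0 < l₁ := by linarith
  have hp₂ : 0 < l₂ := by linarith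
  have hij : i ≤ j := by
    have : (2 : ℝ) ^ i < 2 ^ (j + 1) := by linarith
    have := (pow_lt_pow_iff_right₀ (one_lt_two (α := ℝ))).1 this
    omega
  let M := (finite_setOf_house_le k (2 * (l₂ / l₁ / 2))).toFinset
  have hM := pow_le_card_mul_sqrt_discr k (r := l₂ / l₁ / 2) (by positivity) M (by simp [M])
  have hM' : ∀ m ∈ M, house (m : k) ≤ l₂ / l₁ := by
    intro m hm
    have : house (m : k) ≤ 2 * (l₂ / l₁ / 2) := by simpa [M] using hm
    linarith
  have ha0' : algebraMap k K a ≠ 0 := by simpa using ha0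
  -- The monic relation for A is a² g(x/a) with g = a x³ - b x² + c x - d.
  have hgen : IsCubicGenerator (a, b, c, d) ((A : K) / algebraMap k K a) := by
    refine ⟨fun x hx => hA (a * x) ?_, ?_⟩
    · rw [map_mul, ← hx]
      field_simp
    · simp only [map_mul, map_pow] at hrel ⊢
      field_simp
      linear_combination hrel
  have hi2 : (2 : ℝ) ^ (i + 1) = 2 * 2 ^ i := by ring
  have hj2 : (2 : ℝ) ^ (j + 1) = 2 * 2 ^ j := by ring
  have h4i : (4 : ℝ) ^ i = (2 ^ i) ^ 2 := by rw [← pow_mul, mul_comm, pow_mul]; norm_num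
  have h4j : (4 : ℝ) ^ j = (2 ^ j) ^ 2 := by rw [← pow_mul, mul_comm, pow_mul]; norm_num
  rw [hi2] at hi'
  rw [hj2] at hj'
  have hI : (0 : ℝ) < 2 ^ i := by positivity
  have hJ : (0 : ℝ) < 2 ^ j := by positivity
  refine ⟨i, j, hij, ?_, M.image (cubicTranslate (a, b, c, d)), ?_, ?_⟩
  · calc ((2 : ℝ) ^ (i + j)) ^ n ≤ (l₁ * l₂) ^ n := by
          rw [pow_add]
          gcongr
      _ ≤ _ := hvol
      _ ≤ _ := mul_le_mul_of_nonneg_right (by linarith) (Real.sqrt_nonneg _)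
  · rw [Finset.card_image_of_injective _ (cubicTranslate_injective ha0)]
    have e1 : (2 : ℝ) ^ j / 2 ^ i ≤ 4 * (l₂ / l₁ / 2) := by
      rw [show 4 * (l₂ / l₁ / 2) = 2 * l₂ / l₁ by ring, div_le_div_iff₀ hI hp₁]
      nlinarith
    calc _ ≤ (4 * (l₂ / l₁ / 2)) ^ n := by gcongr
      _ = 4 ^ n * (l₂ / l₁ / 2) ^ n := mul_pow _ _ _
      _ ≤ 4 ^ n * (M.card * S) := by gcongr
      _ = 4 ^ n * S * M.card := by ring
      _ ≤ _ := mul_le_mul_of_nonneg_right hSC (Nat.cast_nonneg _)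
  · intro t ht
    obtain ⟨m, hm, rfl⟩ := Finset.mem_image.1 ht
    obtain ⟨b1, b2, b3⟩ := house_cubicTranslate_le (t := (a, b, c, d)) hp₁ hp₂ (by linarith)
      ha hb hc hd (hM' m hm)
    have hC0 : 0 ≤ C := by linarith
    refine ⟨⟨ha0, ?_, ?_, ?_, ?_⟩, ⟨_, hgen.translate m⟩, ?_⟩
    · have e1 : house (a : k) ≤ 16 * C * (4 ^ i / 2 ^ j) := by
        rw [← mul_div_assoc, le_div_iff₀ hJ, h4i]
        calc _ ≤ house (a : k) * l₂ := by gcongr; exact house_nonneg _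
          _ ≤ C * l₁ ^ 2 := ha
          _ ≤ C * (2 * 2 ^ i) ^ 2 := by gcongr
          _ = 4 * C * (2 ^ i) ^ 2 := by ring
          _ ≤ 16 * C * (2 ^ i) ^ 2 :=
            mul_le_mul_of_nonneg_right (by linarith) (by positivity)
      exact e1.trans (mul_le_mul_of_nonneg_right hCC (by positivity))
    · calc _ ≤ _ := b1
        _ ≤ 4 * C * (2 * 2 ^ i) := by gcongr
        _ = 8 * C * 2 ^ i := by ring
        _ ≤ 16 * C * 2 ^ i := mul_le_mul_of_nonneg_right (by linarith) hI.le
        _ ≤ _ := mul_le_mul_of_nonneg_right hCC (by positivity)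
    · calc _ ≤ _ := b2
        _ ≤ 6 * C * (2 * 2 ^ j) := by gcongr
        _ = 12 * C * 2 ^ j := by ring
        _ ≤ 16 * C * 2 ^ j := mul_le_mul_of_nonneg_right (by linarith) hJ.le
        _ ≤ _ := mul_le_mul_of_nonneg_right hCC (by positivity)
    · calc _ ≤ _ := b3
        _ ≤ 4 * C * ((2 * 2 ^ j) ^ 2 / 2 ^ i) := by gcongr
        _ = 16 * C * (4 ^ j / 2 ^ i) := by rw [h4j]; ring
        _ ≤ _ := mul_le_mul_of_nonneg_right hCC (by positivity)
    · intro p hp hp0 P hP hdvd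
      have hmax := hp.isMaximal hp0
      rw [cubicDiscr_cubicTranslate]
      exact mem_or_cubicDiscr_mem_of_sq_dvd_map h3 hA hrel hp0 hdvd

end CubicFamily

/-! ### Dyadic summation and counts per box -/

section Summation

open Module

theorem sum_range_pow_le {r : ℝ} (hr : 2 ≤ r) (m : ℕ) :
    ∑ i ∈ Finset.range (m + 1), r ^ i ≤ 2 * r ^ m := by
  induction m with
  | zero => simp
  | succ m ih =>
    rw [Finset.sum_range_succ]
    have : r ^ (m + 1) = r * r ^ m := pow_succ' r m
    have : 0 ≤ r ^ m := by positivity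
    nlinarith

/-- Here s = i + j, and i ≤ s/2 encodes i ≤ j. The terms are v^(10i - 2s) and v^(4i + 2s)/N,
geometric in i and dominated by i = s/2, which leaves v^(3s) and v^(4s)/N. -/
theorem sum_dyadic_le {v N : ℝ} (hv : 0 < v) (hv2 : 2 ≤ v ^ 2) (hN : 0 < N) (L : ℕ) :
    ∑ s ∈ Finset.range (L + 1), ∑ i ∈ Finset.range (s / 2 + 1),
      (v ^ (8 * i) / v ^ (2 * (s - i)) + v ^ (6 * i + 2 * (s - i)) / N) ≤
    4 * (v ^ L) ^ 3 + 4 * ((v ^ L) ^ 4 / N) := by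
  have hv1 : 1 ≤ v := by nlinarith
  have hv3 : 2 ≤ v ^ 3 := hv2.trans (pow_le_pow_right₀ hv1 (by norm_num))
  have hv4 : 2 ≤ v ^ 4 := hv2.trans (pow_le_pow_right₀ hv1 (by norm_num))
  have hv10 : 2 ≤ v ^ 10 := hv2.trans (pow_le_pow_right₀ hv1 (by norm_num))
  have inner : ∀ s ∈ Finset.range (L + 1), ∑ i ∈ Finset.range (s / 2 + 1),
      (v ^ (8 * i) / v ^ (2 * (s - i)) + v ^ (6 * i + 2 * (s - i)) / N) ≤
      2 * (v ^ 3) ^ s + 2 * (v ^ 4) ^ s / N := by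
    intro s _
    have hterm : ∀ i ∈ Finset.range (s / 2 + 1),
        v ^ (8 * i) / v ^ (2 * (s - i)) + v ^ (6 * i + 2 * (s - i)) / N =
        (v ^ 10) ^ i / v ^ (2 * s) + (v ^ 4) ^ i * (v ^ (2 * s) / N) := by
      intro i hi
      rw [Finset.mem_range] at hi
      obtain ⟨j, rfl⟩ : ∃ j, s = i + j := ⟨s - i, by omega⟩
      rw [Nat.add_sub_cancel_left, ← pow_mul, ← pow_mul]
      congr 1
      · rw [div_eq_div_iff (by positivity) (by positivity), ← pow_add, ← pow_add]
        congr 1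
        ring
      · rw [← mul_div_assoc, ← pow_add]
        congr 2
        ring
    rw [Finset.sum_congr rfl hterm, Finset.sum_add_distrib, ← Finset.sum_div, ← Finset.sum_mul]
    have h1 := sum_range_pow_le hv10 (s / 2)
    have h2 := sum_range_pow_le hv4 (s / 2)
    have h3 : (v ^ 10) ^ (s / 2) ≤ v ^ (5 * s) := by
      rw [← pow_mul]; exact pow_le_pow_right₀ hv1 (by omega)
    have h4 : (v ^ 4) ^ (s / 2) ≤ v ^ (2 * s) := by
      rw [← pow_mul]; exact pow_le_pow_right₀ hv1 (by omega)
    refine add_le_add ?_ ?_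
    · rw [div_le_iff₀ (by positivity), ← pow_mul, mul_assoc, ← pow_add]
      rw [show 3 * s + 2 * s = 5 * s by ring]
      linarith
    · calc _ ≤ 2 * v ^ (2 * s) * (v ^ (2 * s) / N) := by gcongr; linarith
        _ = _ := by
          rw [mul_assoc, ← mul_div_assoc, ← pow_add, ← pow_mul, mul_div_assoc]
          congr 3
          ring
  refine (Finset.sum_le_sum inner).trans ?_
  rw [Finset.sum_add_distrib, ← Finset.sum_div, ← Finset.mul_sum, ← Finset.mul_sum]
  have h1 := sum_range_pow_le hv3 L
  have h2 := sum_range_pow_le hv4 L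
  rw [← pow_mul, ← pow_mul, mul_comm L, mul_comm L, pow_mul, pow_mul, ← mul_div_assoc]
  refine add_le_add (by linarith) ?_
  rw [div_le_div_iff_of_pos_right hN]
  linarith

/-- A prime of norm above 4^12 pays for its own factor 4; the finitely many others go into the
constant. -/
theorem exists_four_pow_card_le (k : Type*) [Field k] [NumberField k] : ∃ C : ℝ, 1 ≤ C ∧
    ∀ Q : Finset (Ideal (𝓞 k)), (∀ p ∈ Q, p ≠ ⊥) →
      (4 : ℝ) ^ Q.card ≤ C * (∏ p ∈ Q, (Ideal.absNorm p : ℝ)) ^ (1 / 12 : ℝ) := by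
  classical
  let B := (Ideal.finite_setOfPred_absNorm_le (S := 𝓞 k) (4 ^ 12)).toFinset
  refine ⟨4 ^ B.card, one_le_pow₀ (by norm_num), fun Q hQ => ?_⟩
  have hN : ∀ p ∈ Q, (1 : ℝ) ≤ Ideal.absNorm p := fun p hp => by
    exact_mod_cast Nat.pos_of_ne_zero (Ideal.absNorm_eq_zero_iff.not.2 (hQ p hp))
  rw [← Real.finsetProd_rpow _ _ fun p hp => by linarith [hN p hp], ← Finset.prod_const]
  calc ∏ _p ∈ Q, (4 : ℝ) ≤ ∏ p ∈ Q, ((if p ∈ B then 4 else 1) *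
        (Ideal.absNorm p : ℝ) ^ (1 / 12 : ℝ)) := by
        refine Finset.prod_le_prod (fun _ _ => by norm_num) fun p hp => ?_
        have h1 : 1 ≤ (Ideal.absNorm p : ℝ) ^ (1 / 12 : ℝ) :=
          Real.one_le_rpow (hN p hp) (by norm_num)
        split_ifs with hB
        · linarith
        · have h2 : (4 : ℝ) ^ 12 ≤ Ideal.absNorm p := by
            have : ¬ Ideal.absNorm p ≤ 4 ^ 12 := by simpa [B] using hB
            exact_mod_cast (not_le.1 this).le
          have h3 := Real.rpow_le_rpow (by positivity) h2 (by norm_num : (0 : ℝ) ≤ 1 / 12)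
          rw [← Real.rpow_natCast, ← Real.rpow_mul (by norm_num)] at h3
          norm_num at h3 ⊢
          exact h3
    _ = (∏ p ∈ Q, if p ∈ B then (4 : ℝ) else 1) *
        ∏ p ∈ Q, (Ideal.absNorm p : ℝ) ^ (1 / 12 : ℝ) := Finset.prod_mul_distrib
    _ ≤ _ := by
        refine mul_le_mul_of_nonneg_right ?_ (Finset.prod_nonneg fun p _ => by positivity)
        rw [← Finset.prod_filter, Finset.prod_const]
        refine pow_le_pow_right₀ (by norm_num) (Finset.card_le_card fun p hp => ?_)
        exact (Finset.mem_filter.1 hp).2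

/-- The primes containing 3, at which -27a² vanishes, must be discarded. Their product contains 3,
so its norm is at most 3^n. -/
theorem prod_absNorm_le_three_pow_mul {k : Type*} [Field k] [NumberField k]
    (Q : Finset (Ideal (𝓞 k))) (hQ : ∀ p ∈ Q, p.IsPrime ∧ p ≠ ⊥)
    [DecidablePred fun p : Ideal (𝓞 k) => (3 : 𝓞 k) ∉ p] :
    ∏ p ∈ Q, (Ideal.absNorm p : ℝ) ≤
      3 ^ finrank ℚ k * ∏ p ∈ Q.filter fun p => (3 : 𝓞 k) ∉ p, (Ideal.absNorm p : ℝ) := by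
  classical
  rw [← Finset.prod_filter_mul_prod_filter_not Q (fun p => (3 : 𝓞 k) ∈ p)]
  refine mul_le_mul_of_nonneg_right ?_ (Finset.prod_nonneg fun _ _ => by positivity)
  have h1 : (3 : 𝓞 k) ∈ ∏ p ∈ Q.filter fun p => (3 : 𝓞 k) ∈ p, p :=
    mem_prod_of_forall_mem (fun p hp => hQ p (Finset.mem_filter.1 hp).1)
      fun p hp => (Finset.mem_filter.1 hp).2
  have h2 := absNorm_le_house_pow _ h1 (OfNat.ofNat_ne_zero 3)
  rw [map_prod, Nat.cast_prod] at h2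
  have h3 : house ((3 : 𝓞 k) : k) = 3 := by
    have := house_intCast (K := k) 3
    rw [RingOfIntegers.coe_eq_algebraMap, map_ofNat]
    simpa using this
  rwa [h3] at h2

/-- Count of a family of fields whose attached sets of cubic polynomials are disjoint and lie in a
dyadic box. -/
theorem card_le_of_disjoint_cubic_families {k : Type*} [Field k] [NumberField k] {σ : Type*}
    (J : Finset σ) (F : σ → Finset (𝓞 k × 𝓞 k × 𝓞 k × 𝓞 k)) (Q : Finset (Ideal (𝓞 k)))
    (hQ : ∀ p ∈ Q, p.IsPrime ∧ p ≠ ⊥) (h3 : ∀ p ∈ Q, (3 : 𝓞 k) ∉ p) {C v : ℝ} (hC : 1 ≤ C)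
    (hv : 0 < v) (hv2 : v ^ 2 = 2 ^ finrank ℚ k) {i j : ℕ}
    (hdisj : ∀ s ∈ J, ∀ s' ∈ J, ∀ t, t ∈ F s → t ∈ F s' → s = s')
    (hcard : ∀ s ∈ J, ((2 : ℝ) ^ j / 2 ^ i) ^ finrank ℚ k ≤ C * (F s).card)
    (hbox : ∀ s ∈ J, ∀ t ∈ F s, t.1 ≠ 0 ∧ house (t.1 : k) ≤ C * (4 ^ i / 2 ^ j) ∧
      house (t.2.1 : k) ≤ C * 2 ^ i ∧ house (t.2.2.1 : k) ≤ C * 2 ^ j ∧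
      house (t.2.2.2 : k) ≤ C * (4 ^ j / 2 ^ i))
    (hd : ∀ s ∈ J, ∀ t ∈ F s, ∀ p ∈ Q, t.1 ∈ p ∨ cubicDiscr t.1 t.2.1 t.2.2.1 t.2.2.2 ∈ p) :
    (J.card : ℝ) ≤ 8 * 256 ^ finrank ℚ k * C ^ (4 * finrank ℚ k + 1) * 4 ^ Q.card *
      (v ^ (8 * i) / v ^ (2 * j) + v ^ (6 * i + 2 * j) / ∏ p ∈ Q, (Ideal.absNorm p : ℝ)) := by
  classical
  set n := finrank ℚ k with hn
  set N := ∏ p ∈ Q, (Ideal.absNorm p : ℝ) with hN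
  have hN0 : 0 < N := Finset.prod_pos fun p hp => by
    exact_mod_cast Nat.pos_of_ne_zero (Ideal.absNorm_eq_zero_iff.not.2 (hQ p hp).2)
  let T := J.biUnion F
  have hT := card_cubic_le Q hQ h3 T (H₁ := C * (4 ^ i / 2 ^ j)) (H₂ := C * 2 ^ i)
    (H₃ := C * 2 ^ j) (H₄ := C * (4 ^ j / 2 ^ i)) (by positivity)
    (one_le_mul_of_one_le_of_one_le hC (one_le_pow₀ one_le_two))
    (one_le_mul_of_one_le_of_one_le hC (one_le_pow₀ one_le_two)) (by positivity)
    (fun t ht => by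
      obtain ⟨s, hs, hst⟩ := Finset.mem_biUnion.1 ht
      exact hbox s hs t hst)
    (fun t ht => by
      obtain ⟨s, hs, hst⟩ := Finset.mem_biUnion.1 ht
      exact hd s hs t hst)
  have hTcard : T.card = ∑ s ∈ J, (F s).card := by
    refine Finset.card_biUnion fun s hs s' hs' hne => Finset.disjoint_left.2 fun t ht ht' => ?_
    exact hne (hdisj s hs s' hs' t ht ht')
  -- Disjointness turns the count of tuples into a count of fields, saving the size of a single
  -- family.
  have h1 : (J.card : ℝ) * ((2 : ℝ) ^ j / 2 ^ i) ^ n ≤ C * T.card := by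
    rw [hTcard, Nat.cast_sum, Finset.mul_sum, ← nsmul_eq_mul, ← Finset.sum_const]
    exact Finset.sum_le_sum hcard
  have hpow : ∀ m : ℕ, ((2 : ℝ) ^ m) ^ n = v ^ (2 * m) := fun m => by
    rw [pow_mul, hv2, ← pow_mul, ← pow_mul, mul_comm]
  have h4 : ∀ m : ℕ, (4 : ℝ) ^ m = 2 ^ (2 * m) := fun m => by rw [pow_mul]; norm_num
  have e1 : (C * (4 ^ i / 2 ^ j) * (C * 2 ^ i) * (C * 2 ^ j)) ^ n = C ^ (3 * n) * v ^ (6 * i) := by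
    have : C * (4 ^ i / 2 ^ j) * (C * 2 ^ i) * (C * 2 ^ j) = C ^ 3 * 2 ^ (3 * i) := by
      rw [h4]
      field_simp
      ring
    rw [this, mul_pow, hpow, ← pow_mul]
    congr 2
    ring
  have e2 : (C * (4 ^ j / 2 ^ i)) ^ n = C ^ n * (v ^ (4 * j) / v ^ (2 * i)) := by
    rw [mul_pow, div_pow, h4, hpow, hpow]
    congr 3
    ring
  rw [e1, e2] at hT
  rw [div_pow, hpow, hpow] at h1
  have hC0 : 0 < C := by linarith
  have hCn : 1 ≤ C ^ n := one_le_pow₀ hC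
  have h5 : (J.card : ℝ) * (v ^ (2 * j) / v ^ (2 * i)) ≤
      C * (8 * 256 ^ n * 4 ^ Q.card * (C ^ (3 * n) * v ^ (6 * i)) *
        (C ^ n * (1 + v ^ (4 * j) / v ^ (2 * i) / N))) := by
    refine h1.trans (mul_le_mul_of_nonneg_left (hT.trans ?_) hC0.le)
    refine mul_le_mul_of_nonneg_left ?_ (by positivity)
    rw [mul_add, mul_one, mul_div_assoc]
    gcongr
  rw [← le_div_iff₀ (by positivity)] at h5
  refine h5.trans (le_of_eq ?_)
  rw [show C ^ (4 * n + 1) = C ^ (3 * n) * C ^ n * C by ring]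
  have : v ^ (6 * i + 2 * j) = v ^ (6 * i) * v ^ (2 * j) := pow_add _ _ _
  have h8 : v ^ (8 * i) = v ^ (6 * i) * v ^ (2 * i) := by rw [← pow_add]; congr 1; ring
  have h4j : v ^ (4 * j) = v ^ (2 * j) * v ^ (2 * j) := by rw [← pow_add]; congr 1; ring
  rw [this, h8, h4j]
  field_simp

end Summation

/-! ### Assembling the bound -/

section Main

open Module UniqueFactorizationMonoid

theorem exists_finset_prime_prod_eq {k : Type*} [Field k] [NumberField k] {q : Ideal (𝓞 k)}
    (hq : Squarefree q) : ∃ Q : Finset (Ideal (𝓞 k)),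
      (∀ p ∈ Q, p.IsPrime ∧ p ≠ ⊥ ∧ p ∣ q) ∧ ∏ p ∈ Q, p = q := by
  classical
  have hq0 : q ≠ 0 := hq.ne_zero
  refine ⟨(normalizedFactors q).toFinset, fun p hp => ?_, ?_⟩
  · rw [Multiset.mem_toFinset] at hp
    have h := prime_of_normalized_factor p hp
    exact ⟨Ideal.isPrime_of_prime h, h.ne_zero, dvd_of_mem_normalizedFactors hp⟩
  · have hnd := (squarefree_iff_nodup_normalizedFactors hq0).1 hq
    have h : ∏ p ∈ (normalizedFactors q).toFinset, p = (normalizedFactors q).prod := by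
      rw [Finset.prod, Multiset.toFinset_val, hnd.dedup, Multiset.map_id']
    rw [h]
    exact associated_iff_eq.1 (prod_normalizedFactors hq0)

/-- V ≪ X^(1/4), so V³ ≪ X^(3/4) ≤ X/N^(1/4) because N ≤ X, while V⁴/N' ≪ X/N. The factor N^(1/12)
lowers the saving from 1/4 to 1/6. -/
theorem dyadic_bound_le {C X N N' V B : ℝ} (hC : 1 ≤ C) (hX : 0 < X) (hN : 1 ≤ N) (hNX : N ≤ X)
    (hN' : 0 < N') (hNN' : N ≤ B * N') (hV0 : 0 ≤ V) (hV : V ^ 2 ≤ C * √X) :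
    N ^ (1 / 12 : ℝ) * (4 * V ^ 3 + 4 * (V ^ 4 / N')) ≤
      (4 * C ^ 3 + 4 * C ^ 4 * B) * (X / N ^ (1 / 6 : ℝ)) := by
  have hN0 : 0 < N := by linarith
  have hB : 0 < B := by
    by_contra h
    nlinarith
  obtain ⟨y, hy⟩ : ∃ y : ℝ, y = X ^ (1 / 4 : ℝ) := ⟨_, rfl⟩
  have hy0 : 0 < y := hy ▸ Real.rpow_pos_of_pos hX _
  have hy4 : y ^ 4 = X := by
    rw [hy, ← Real.rpow_natCast, ← Real.rpow_mul hX.le]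
    norm_num
  have hy2 : √X = y ^ 2 := by
    rw [← hy4, show y ^ 4 = (y ^ 2) ^ 2 by ring, Real.sqrt_sq (by positivity)]
  have hVy : V ≤ C * y := by
    rw [hy2] at hV
    refine (pow_le_pow_iff_left₀ hV0 (by positivity) two_ne_zero).1 (hV.trans ?_)
    rw [mul_pow]
    exact mul_le_mul_of_nonneg_right (le_self_pow₀ hC two_ne_zero) (by positivity)
  have hV3 : V ^ 3 ≤ C ^ 3 * (X / N ^ (1 / 4 : ℝ)) := by
    calc V ^ 3 ≤ (C * y) ^ 3 := by gcongr
      _ = C ^ 3 * (X / y) := by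
          rw [← hy4]
          field_simp
      _ ≤ _ := by
          rw [hy]
          gcongr
  have hV4 : V ^ 4 / N' ≤ C ^ 4 * B * (X / N ^ (1 / 4 : ℝ)) := by
    calc V ^ 4 / N' ≤ (C * y) ^ 4 / (N / B) := by
          gcongr
          rwa [div_le_iff₀' hB]
      _ = C ^ 4 * B * (X / N) := by
          rw [mul_pow, hy4]
          field_simp
      _ ≤ _ := by
          gcongr
          exact Real.rpow_le_self_of_one_le hN (by norm_num)
  have hdiv : N ^ (1 / 12 : ℝ) * (X / N ^ (1 / 4 : ℝ)) = X / N ^ (1 / 6 : ℝ) := by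
    have h : N ^ (1 / 4 : ℝ) = N ^ (1 / 12 : ℝ) * N ^ (1 / 6 : ℝ) := by
      rw [← Real.rpow_add hN0]
      norm_num
    rw [h]
    field_simp
  calc N ^ (1 / 12 : ℝ) * (4 * V ^ 3 + 4 * (V ^ 4 / N'))
      ≤ N ^ (1 / 12 : ℝ) * (4 * (C ^ 3 * (X / N ^ (1 / 4 : ℝ))) +
          4 * (C ^ 4 * B * (X / N ^ (1 / 4 : ℝ)))) := by gcongr
    _ = (4 * C ^ 3 + 4 * C ^ 4 * B) * (N ^ (1 / 12 : ℝ) * (X / N ^ (1 / 4 : ℝ))) := by ring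
    _ = _ := by rw [hdiv]

/-- Every finite set of classes of cubic fields ramified at `q` with `|disc| ≤ X` has at most
`O(X / N(q)^(1/6))` elements. -/
theorem exists_card_le_of_subset_partiallyRamifiedCubicClasses (k : Type*) [Field k]
    [NumberField k] : ∃ C : ℝ, 0 < C ∧ ∀ q : Ideal (𝓞 k), Squarefree q → ∀ X : ℝ, 0 < X →
      ∀ J : Finset (Quotient (CubicExtension.instSetoid k)),
        (∀ s ∈ J, s ∈ partiallyRamifiedCubicClasses k q X) →
        (J.card : ℝ) ≤ C * X / (Ideal.absNorm q : ℝ) ^ (1 / 6 : ℝ) := by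
  classical
  obtain ⟨C, hC, key⟩ := exists_cubic_family k
  obtain ⟨W, hW, hW'⟩ := exists_four_pow_card_le k
  set n := finrank ℚ k with hn
  have hn1 : 1 ≤ n := finrank_pos
  set C₁ : ℝ := 8 * 256 ^ n * C ^ (4 * n + 1) with hC₁
  have hC0 : 0 < C := by linarith
  have hC₁0 : 0 < C₁ := by positivity
  refine ⟨C₁ * W * (4 * C ^ 3 + 4 * C ^ 4 * 3 ^ n), by positivity, ?_⟩
  intro q hq X hX J hJ
  have hNq : 0 < (Ideal.absNorm q : ℝ) := by
    exact_mod_cast Nat.pos_of_ne_zero (Ideal.absNorm_eq_zero_iff.not.2 hq.ne_zero)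
  rcases J.eq_empty_or_nonempty with rfl | ⟨s₀, hs₀⟩
  · rw [Finset.card_empty, Nat.cast_zero]
    positivity
  obtain ⟨Q, hQ, hQq⟩ := exists_finset_prime_prod_eq hq
  have hNQ : ∏ p ∈ Q, (Ideal.absNorm p : ℝ) = Ideal.absNorm q := by
    rw [← hQq, map_prod, Nat.cast_prod]
  choose K hK hKs using fun s : {s // s ∈ J} => hJ s s.2
  have hram : ∀ s, ∀ p ∈ Q, ∃ P : Ideal (𝓞 (K s).1), P.IsPrime ∧
      P ^ 2 ∣ p.map (algebraMap (𝓞 k) (𝓞 (K s).1)) := by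
    intro s p hp
    obtain ⟨P₁, P₂, hP₁, -, -, h⟩ := (hK s).2.1 p (hQ p hp).1 (hQ p hp).2.2
    exact ⟨P₁, hP₁, h ▸ dvd_mul_right _ _⟩
  -- One field in the family suffices: its discriminant is at least N(q). The empty family was
  -- treated separately.
  have hqX : (Ideal.absNorm q : ℝ) ≤ X := by
    have h1 := prod_absNorm_le_abs_discr (K := (K ⟨s₀, hs₀⟩).1) Q
      fun p hp => ⟨(hQ p hp).1, (hQ p hp).2.1, hram _ p hp⟩
    rw [Nat.cast_prod, hNQ] at h1
    exact h1.trans (hK ⟨s₀, hs₀⟩).2.2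
  choose i j hij hvol F hcard hF using fun s => key (K s).1 (K s).2
  set Q' := Q.filter fun p => (3 : 𝓞 k) ∉ p with hQ'
  have hQ'Q : Q' ⊆ Q := Finset.filter_subset _ _
  set N' := ∏ p ∈ Q', (Ideal.absNorm p : ℝ) with hN'
  have hN'pos : 0 < N' := Finset.prod_pos fun p hp => by
    exact_mod_cast Nat.pos_of_ne_zero
      (Ideal.absNorm_eq_zero_iff.not.2 (hQ p (hQ'Q hp)).2.1)
  have hNN' : (Ideal.absNorm q : ℝ) ≤ 3 ^ n * N' := by
    rw [← hNQ]
    exact prod_absNorm_le_three_pow_mul Q fun p hp => ⟨(hQ p hp).1, (hQ p hp).2.1⟩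
  have hN'N : N' ≤ Ideal.absNorm q := by
    have h : ∏ p ∈ Q', Ideal.absNorm p ≤ Ideal.absNorm q := by
      rw [← map_prod, ← hQq]
      refine Nat.le_of_dvd (Nat.pos_of_ne_zero ?_)
        (map_dvd Ideal.absNorm (Finset.prod_dvd_prod_of_subset _ _ _ hQ'Q))
      rw [hQq]
      exact Ideal.absNorm_eq_zero_iff.not.2 hq.ne_zero
    rw [hN', ← Nat.cast_prod]
    exact Nat.cast_le.2 h
  -- The half power of 2^n keeps the dominant term v^(3s) an integral power for odd s too.
  set v : ℝ := √(2 ^ n) with hv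
  have hv0 : 0 < v := Real.sqrt_pos.2 (by positivity)
  have hv2 : v ^ 2 = 2 ^ n := Real.sq_sqrt (by positivity)
  have hv2' : 2 ≤ v ^ 2 := by
    rw [hv2]
    calc (2 : ℝ) = 2 ^ 1 := (pow_one _).symm
      _ ≤ 2 ^ n := pow_le_pow_right₀ one_le_two hn1
  have hbound : ∀ s, (v ^ 2) ^ (i s + j s) ≤ C * √X := by
    intro s
    rw [hv2, ← pow_mul, mul_comm, pow_mul]
    refine (hvol s).trans (mul_le_mul_of_nonneg_left (Real.sqrt_le_sqrt ?_) hC0.le)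
    exact (hK s).2.2
  have hZ : 1 ≤ C * √X := (one_le_pow₀ (by linarith)).trans (hbound ⟨s₀, hs₀⟩)
  obtain ⟨L, hL, hL'⟩ := exists_nat_pow_near hZ (by linarith : 1 < v ^ 2)
  have hsL : ∀ s, i s + j s < L + 1 := fun s =>
    (pow_lt_pow_iff_right₀ (by linarith : 1 < v ^ 2)).1 ((hbound s).trans_lt hL')
  have hfiber : ∀ x ∈ (Finset.range (L + 1)).sigma fun s => Finset.range (s / 2 + 1),
      (((Finset.univ : Finset {s // s ∈ J}).filter
        fun s => (⟨i s + j s, i s⟩ : Σ _ : ℕ, ℕ) = x).card : ℝ) ≤ C₁ * 4 ^ Q'.card *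
        (v ^ (8 * x.2) / v ^ (2 * (x.1 - x.2)) + v ^ (6 * x.2 + 2 * (x.1 - x.2)) / N') := by
    rintro ⟨S, a⟩ -
    have hmem : ∀ s ∈ (Finset.univ : Finset {s // s ∈ J}).filter
        fun s => (⟨i s + j s, i s⟩ : Σ _ : ℕ, ℕ) = ⟨S, a⟩, i s = a ∧ j s = S - a := by
      intro s hs
      have h := (Finset.mem_filter.1 hs).2
      simp only [Sigma.mk.injEq, heq_eq_eq] at h
      omega
    refine card_le_of_disjoint_cubic_families _ F Q'
      (fun p hp => ⟨(hQ p (hQ'Q hp)).1, (hQ p (hQ'Q hp)).2.1⟩)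
      (fun p hp => (Finset.mem_filter.1 hp).2) hC hv0 hv2 ?_ ?_ ?_ ?_
    · intro s _ s' _ t ht ht'
      obtain ⟨⟨h0, -⟩, ⟨ρ, hρ⟩, -⟩ := hF s t ht
      obtain ⟨-, ⟨ρ', hρ'⟩, -⟩ := hF s' t ht'
      have := hρ.nonempty_algEquiv (K s).2 (K s').2 h0 hρ'
      apply Subtype.ext
      rw [← hKs s, ← hKs s']
      exact Quotient.sound this
    · intro s hs
      obtain ⟨e1, e2⟩ := hmem s hs
      have h := hcard s
      rw [e1, e2] at h
      exact h
    · intro s hs t ht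
      obtain ⟨e1, e2⟩ := hmem s hs
      have h := (hF s t ht).1
      rw [e1, e2] at h
      exact h
    · intro s _ t ht p hp
      obtain ⟨P, hP, hP'⟩ := hram s p (hQ'Q hp)
      exact (hF s t ht).2.2 p (hQ p (hQ'Q hp)).1 (hQ p (hQ'Q hp)).2.1 P hP hP'
  have htotal : (J.card : ℝ) ≤
      C₁ * 4 ^ Q'.card * (4 * (v ^ L) ^ 3 + 4 * ((v ^ L) ^ 4 / N')) := by
    have h1 : J.card = (Finset.univ : Finset {s // s ∈ J}).card := by
      rw [Finset.card_univ, Fintype.card_coe]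
    rw [h1, Finset.card_eq_sum_card_fiberwise (f := fun s => (⟨i s + j s, i s⟩ : Σ _ : ℕ, ℕ))
      (t := (Finset.range (L + 1)).sigma fun s => Finset.range (s / 2 + 1)) (by
        intro s _
        simp only [Finset.coe_sigma, Set.mem_sigma_iff, Finset.coe_range, Set.mem_Iio]
        have := hsL s
        have := hij s
        omega), Nat.cast_sum]
    refine (Finset.sum_le_sum hfiber).trans ?_
    rw [← Finset.mul_sum, Finset.sum_sigma]
    exact mul_le_mul_of_nonneg_left (sum_dyadic_le hv0 hv2' hN'pos L) (by positivity)
  have h4 : (4 : ℝ) ^ Q'.card ≤ W * (Ideal.absNorm q : ℝ) ^ (1 / 12 : ℝ) := by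
    refine (hW' Q' fun p hp => (hQ p (hQ'Q hp)).2.1).trans ?_
    exact mul_le_mul_of_nonneg_left (Real.rpow_le_rpow hN'pos.le hN'N (by norm_num))
      (zero_le_one.trans hW)
  clear_value C₁ v N'
  have hN1 : 1 ≤ (Ideal.absNorm q : ℝ) :=
    Nat.one_le_cast.2 (Nat.pos_of_ne_zero (Ideal.absNorm_eq_zero_iff.not.2 hq.ne_zero))
  have hL2 : (v ^ L) ^ 2 ≤ C * √X := by
    rwa [← pow_mul, mul_comm L 2, pow_mul]
  have hreal := dyadic_bound_le hC hX hN1 hqX hN'pos hNN' (pow_pos hv0 L).le hL2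
  refine htotal.trans ?_
  calc C₁ * 4 ^ Q'.card * (4 * (v ^ L) ^ 3 + 4 * ((v ^ L) ^ 4 / N'))
      ≤ C₁ * (W * (Ideal.absNorm q : ℝ) ^ (1 / 12 : ℝ)) *
          (4 * (v ^ L) ^ 3 + 4 * ((v ^ L) ^ 4 / N')) := by
        refine mul_le_mul_of_nonneg_right (mul_le_mul_of_nonneg_left h4 hC₁0.le) ?_
        positivity
    _ = C₁ * W * ((Ideal.absNorm q : ℝ) ^ (1 / 12 : ℝ) *
          (4 * (v ^ L) ^ 3 + 4 * ((v ^ L) ^ 4 / N'))) := by ring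
    _ ≤ C₁ * W * ((4 * C ^ 3 + 4 * C ^ 4 * 3 ^ n) *
          (X / (Ideal.absNorm q : ℝ) ^ (1 / 6 : ℝ))) :=
        mul_le_mul_of_nonneg_left hreal (by positivity)
    _ = _ := by ring

end Main

theorem theorem3p2 (k : Type*) [Field k] [NumberField k] (ε : ℝ) (hε : 0 < ε) :
    ∃ C : ℝ, 0 < C ∧ ∀ q : Ideal (𝓞 k), Squarefree q → ∀ X : ℝ, 0 < X →
      (partiallyRamifiedCubicClasses k q X).Finite ∧
      ((partiallyRamifiedCubicClasses k q X).ncard : ℝ) ≤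
        C * X / (Ideal.absNorm q : ℝ) ^ ((1 / 6 : ℝ) - ε) := by
  obtain ⟨C, hC, key⟩ := exists_card_le_of_subset_partiallyRamifiedCubicClasses k
  refine ⟨C, hC, fun q hq X hX => ?_⟩
  have hfin : (partiallyRamifiedCubicClasses k q X).Finite := by
    -- The bound is uniform over finite subsets, so an infinite set would contain one that is too
    -- large.
    by_contra hinf
    obtain ⟨J, hJ, hJc⟩ := Set.Infinite.exists_subset_card_eq hinf
      (⌊C * X / (Ideal.absNorm q : ℝ) ^ (1 / 6 : ℝ)⌋₊ + 1)
    have h := key q hq X hX J fun s hs => hJ hs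
    rw [hJc] at h
    push_cast at h
    linarith [Nat.lt_floor_add_one (C * X / (Ideal.absNorm q : ℝ) ^ (1 / 6 : ℝ))]
  refine ⟨hfin, ?_⟩
  have h1 := key q hq X hX hfin.toFinset fun s hs => hfin.mem_toFinset.1 hs
  rw [← Set.ncard_eq_toFinset_card _ hfin] at h1
  have hN : 1 ≤ (Ideal.absNorm q : ℝ) := by
    exact_mod_cast Nat.pos_of_ne_zero (Ideal.absNorm_eq_zero_iff.not.2 hq.ne_zero)
  refine h1.trans ?_
  -- As N(q) ≥ 1, decreasing the exponent from 1/6 only weakens the bound.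
  gcongr
  linarith
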